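/- **Local parity criterion in the top layer.** Let $M_n=\mathbb F_2[\tau,x_1,\dots,x_n,y_1,\dots,y_n]/(x_i^2+\tau y_i)$, with $|\tau|=(0,1)$, $|x_i|=(1,1)$, $|y_i|=(2,1)$ (the standard presentation of $H^{*,*}(BV_n/\mathbb C;\mathbb F_2)$, $V_n=(\mathbb Z/2)^n$), with the $\mathbb F_2[\tau]$-linear action of the motivic Steenrod algebra $A^{*,*}$ generated by $\tau$, the Bockstein $Q_0$ of bidegree $(1,0)$ and the reduced powers $\mathcal P^a$ ($a\ge 1$) of bidegree $(2a,a)$, which is determined by $Q_0x_i=y_i$, $Q_0y_i=0$, $\mathcal P^ax_i=0$ $(a\ge1)$, $\mathcal P^1y_i=y_i^2$, $\mathcal P^ay_i=0$ $(a\ge2)$, $Q_0\tau=\mathcal P^a\tau=0$ and the Cartan formulas $Q_0(uv)=Q_0(u)v+uQ_0(v)$, $\mathcal P^a(uv)=\sum_{i+j=a}\mathcal P^i(u)\mathcal P^j(v)+\tau\sum_{i+j=a-1}Q_0\mathcal P^i(u)\,Q_0\mathcal P^j(v)$, where $\mathcal P^0=1$. Let $N_n=M_n/(\tau)=\Lambda(x_1,\dots,x_n)\otimes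 Y_n$, $Y_n=\mathbb F_2[y_1,\dots,y_n]$, with the induced action of $A^\sharp=A^{*,*}/(\tau)$. Let $A^{>0,*}M_n$ and $A^\sharp_+(N_n)$ be the spans of all $a\cdot u$ with $a$ of positive total degree (topological degree plus weight). For a topological degree $d$ let $M_{d,*}$ and $N_n^{d,*}$ be the parts of degree $d$, and let $QM_n^{d}=M_{d,*}/(A^{>0,*}M_n\cap M_{d,*})$ and $QN_n^{d}=N_n^{d,*}/(A^\sharp_+(N_n)\cap N_n^{d,*})$. Let $n\ge 2$, $1\le k<n$, $d_1=(n-1)(2^k-1)$ and $d=k+2d_1$. For a strictly increasing map $\sigma:\{1,\dots,k\}\to\{1,\dots,n\}$ put $$\sigma(z_k)=\prod_{j=1}^k x_{\sigma(j)}\,y_{\sigma(j)}^{2^k-2^{k-j}-1}\prod_{i\notin \operatorname{im}\sigma}y_i^{2^k-1}.$$ For a monomial $z=\prod_i x_i^{\varepsilon_i}y_i^{e_i}$ $(\varepsilon_i\in\{0,1\})$ let $\alpha_i(z)$ be the number of binary digits $1$ of $\varepsilon_i+2e_i$, and let $\omega_j(z)$ be the number of $i$ for which $\varepsilon_i+2e_i$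 has binary digit $1$ in the place $2^j$. Let $G_n\subset Y_n$ be the span of $P^+(Y_n)$, where $P^+$ is the positive-degree part of the algebra generated by the $\mathcal P^a$, and of all monomials $y\in Y_n$ with $(\omega_1(y),\dots,\omega_k(y))<(n-1,\dots,n-1)$ lexicographically. Let $\Lambda_n^k$ be the degree-$k$ part of $\Lambda(x_1,\dots,x_n)$, let $Y_n^{2d_1}$ be the part of $Y_n$ of topological degree $2d_1$, and let $\pi:\Lambda_n^k\otimes Y_n^{2d_1}\to\Lambda_n^k\otimes(Y_n/G_n)^{2d_1}$ be the quotient map. There is a set $M_0$ of monomials in $\Lambda_n^k\otimes Y_n^{2d_1}$, each with $\alpha_i(z)<k$ for some $i$, such that the elements $\pi(z)$, $z\in M_0$, together with the elements $\pi(\sigma(z_k))$, for all $\sigma$, form a basis of $\Lambda_n^k\otimes(Y_n/G_n)^{2d_1}$. For every such $M_0$, let $U_0=\langle\pi(z)\mid z\in M_0\rangle$ and $V=\langle\pi(\sigma(z_k))\mid\sigma\rangle$, let $\vartheta:N_n^{d,*}\to V$ be the composite of the projection onto $\Lambda_n^k\otimes Y_n^{2d_1}$ (exactly $k$ exterior factors),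 of $\pi$, and of the projection $U_0\oplus V\to V$, and let $\varepsilon:V\to\mathbb F_2$ be the sum of the coordinates with respect to the basis $(\pi(\sigma(z_k)))_\sigma$. Then: 1. $\varepsilon\neq0$ and $\vartheta\bigl(A^\sharp_+(N_n)\cap N_n^{d,*}\bigr)=\ker(\varepsilon)$. 2. If $u\in N_n^{d,*}$ satisfies $\varepsilon(\vartheta(u))=1$, then $u\notin A^\sharp_+(N_n)$. Moreover: 3. If $S$ is a set of strictly increasing maps $\{1,\dots,k\}\to\{1,\dots,n\}$ and $|S|$ is odd, then $\sum_{\sigma\in S}\sigma(z_k)$ lies in degree $d$ and is not hit, neither in $N_n$ nor in $M_n$; that is, it represents a non-zero class in $QN_n^d$ and in $QM_n^d$. -/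

import Mathlib

noncomputable section

namespace MotivicHit

/-! ### The bigraded rings and their Steenrod operations -/

section Ring

/-- The `B`-algebra `B[x₁,…,xₙ,y₁,…,yₙ] / (xᵢ² + τ yᵢ)`, with `xᵢ = inl i` and `yᵢ = inr i`.
For `B = 𝔽₂[τ]` it is `Mₙ = H^{*,*}(BVₙ/ℂ; 𝔽₂)`; for `B = 𝔽₂` and `τ = 0` it is
`Nₙ = Mₙ/(τ) = Λ(x₁,…,xₙ) ⊗ 𝔽₂[y₁,…,yₙ]`. -/
def Mot (B : Type) [CommRing B] (τ : B) (n : ℕ) : Type :=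
  MvPolynomial (Fin n ⊕ Fin n) B ⧸
    Ideal.span (Set.range fun i : Fin n =>
      (MvPolynomial.X (Sum.inl i) ^ 2 + MvPolynomial.C τ * MvPolynomial.X (Sum.inr i) :
        MvPolynomial (Fin n ⊕ Fin n) B))

variable (B : Type) [CommRing B] (τ : B) (n : ℕ)

instance : CommRing (Mot B τ n) := inferInstanceAs (CommRing (_ ⧸ _))

instance : Algebra B (Mot B τ n) :=
  inferInstanceAs (Algebra B (MvPolynomial (Fin n ⊕ Fin n) B ⧸ _))

/-- The quotient map from the polynomial ring. -/
def Mot.mk : MvPolynomial (Fin n ⊕ Fin n) B →ₐ[B] Mot B τ n := Ideal.Quotient.mkₐ B _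

/-- The generator `xᵢ`, of bidegree `(1,1)`. -/
def x (i : Fin n) : Mot B τ n := Mot.mk B τ n (MvPolynomial.X (Sum.inl i))

/-- The generator `yᵢ`, of bidegree `(2,1)`. -/
def y (i : Fin n) : Mot B τ n := Mot.mk B τ n (MvPolynomial.X (Sum.inr i))

lemma x_sq (i : Fin n) : x B τ n i ^ 2 + algebraMap B (Mot B τ n) τ * y B τ n i = 0 := by
  have h : Mot.mk B τ n (MvPolynomial.X (Sum.inl i) ^ 2 +
      MvPolynomial.C τ * MvPolynomial.X (Sum.inr i)) = 0 :=
    Ideal.Quotient.eq_zero_iff_mem.mpr (Ideal.subset_span ⟨i, rfl⟩)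
  rw [map_add, map_pow, map_mul, ← MvPolynomial.algebraMap_eq, AlgHom.commutes] at h
  exact h

/-- An algebra map out of `Mot B τ n` is given by images of the generators satisfying the
relations. -/
def Mot.lift {S : Type} [CommRing S] [Algebra B S] (f g : Fin n → S)
    (h : ∀ i, f i ^ 2 + algebraMap B S τ * g i = 0) : Mot B τ n →ₐ[B] S :=
  Ideal.Quotient.liftₐ _ (MvPolynomial.aeval (Sum.elim f g)) (by
    intro p hp
    have hle : Ideal.span (Set.range fun i : Fin n =>
        (MvPolynomial.X (Sum.inl i) ^ 2 + MvPolynomial.C τ * MvPolynomial.X (Sum.inr i) :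
          MvPolynomial (Fin n ⊕ Fin n) B)) ≤
        RingHom.ker (MvPolynomial.aeval (R := B) (Sum.elim f g)) := by
      rw [Ideal.span_le]
      rintro _ ⟨i, rfl⟩
      simp [RingHom.mem_ker, h]
    exact hle hp)

lemma Mot.lift_x {S : Type} [CommRing S] [Algebra B S] (f g : Fin n → S)
    (h : ∀ i, f i ^ 2 + algebraMap B S τ * g i = 0) (i : Fin n) :
    Mot.lift B τ n f g h (x B τ n i) = f i := by
  have : Mot.lift B τ n f g h (x B τ n i) =
      MvPolynomial.aeval (R := B) (Sum.elim f g) (MvPolynomial.X (Sum.inl i)) := rfl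
  rw [this, MvPolynomial.aeval_X, Sum.elim_inl]

lemma Mot.lift_y {S : Type} [CommRing S] [Algebra B S] (f g : Fin n → S)
    (h : ∀ i, f i ^ 2 + algebraMap B S τ * g i = 0) (i : Fin n) :
    Mot.lift B τ n f g h (y B τ n i) = g i := by
  have : Mot.lift B τ n f g h (y B τ n i) =
      MvPolynomial.aeval (R := B) (Sum.elim f g) (MvPolynomial.X (Sum.inr i)) := rfl
  rw [this, MvPolynomial.aeval_X, Sum.elim_inr]

/-- The ring `R[t][s]/(s² = τ t)` over `R = Mot B τ n`, in which the total Steenrod operation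
takes its values. -/
abbrev TotalTarget : Type :=
  QuadraticAlgebra (Polynomial (Mot B τ n))
    (Polynomial.C (algebraMap B (Mot B τ n) τ) * Polynomial.X) 0

variable [CharP B 2]

/-- The total motivic Steenrod operation
`u ↦ ∑ₐ Pᵃ(u) tᵃ + (∑ₐ Q₀Pᵃ(u) tᵃ) s`, with `s² = τ t`.
It is the `B`-algebra map with `xᵢ ↦ xᵢ + yᵢ s` and `yᵢ ↦ yᵢ + yᵢ² t`; being `B`-linear and
multiplicative it encodes `Q₀ τ = Pᵃ τ = 0` and the Cartan formulas
`Q₀(uv) = Q₀(u) v + u Q₀(v)` and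
`Pᵃ(uv) = ∑_{i+j=a} Pⁱ(u) Pʲ(v) + τ ∑_{i+j=a-1} Q₀Pⁱ(u) Q₀Pʲ(v)`. -/
def total : Mot B τ n →ₐ[B] TotalTarget B τ n :=
  Mot.lift B τ n
    (fun i => ⟨Polynomial.C (x B τ n i), Polynomial.C (y B τ n i)⟩)
    (fun i => ⟨Polynomial.C (y B τ n i) + Polynomial.C (y B τ n i ^ 2) * Polynomial.X, 0⟩)
    (by
      intro i
      have h2 : (2 : Polynomial (Mot B τ n)) = 0 := by
        rw [← map_ofNat (algebraMap B (Polynomial (Mot B τ n))) 2, CharTwo.two_eq_zero, map_zero]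
      have hx := congrArg (Polynomial.C (R := Mot B τ n)) (x_sq B τ n i)
      simp only [map_add, map_mul, map_pow, map_zero] at hx
      have hτ : algebraMap B (TotalTarget B τ n) τ =
          ⟨Polynomial.C (algebraMap B (Mot B τ n) τ), 0⟩ := rfl
      refine (congrArg (fun c : TotalTarget B τ n => _ + c * _) hτ).trans ?_
      ext1
      · simp only [pow_two, QuadraticAlgebra.re_add, QuadraticAlgebra.re_mul,
          QuadraticAlgebra.re_zero, map_mul]
        linear_combination hx + Polynomial.C (algebraMap B (Mot B τ n) τ) * Polynomial.X *
          Polynomial.C (y B τ n i) ^ 2 * h2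
      · simp only [pow_two, QuadraticAlgebra.im_add, QuadraticAlgebra.im_mul,
          QuadraticAlgebra.im_zero]
        linear_combination Polynomial.C (x B τ n i) * Polynomial.C (y B τ n i) * h2)

/-- The reduced power `Pᵃ`, of bidegree `(2a,a)`. -/
def P (a : ℕ) : Module.End B (Mot B τ n) where
  toFun u := (total B τ n u).re.coeff a
  map_add' u v := by simp
  map_smul' c u := by simp

/-- The Bockstein `Q₀`, of bidegree `(1,0)`. -/
def Q₀ : Module.End B (Mot B τ n) where
  toFun u := (total B τ n u).im.coeff 0
  map_add' u v := by simp
  map_smul' c u := by simp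

/-- The operators on `Mot B τ n` given by elements of positive total degree (topological degree
plus weight) of the motivic Steenrod algebra. This algebra is generated by `τ`, `Q₀` and the `Pᵃ`,
`a ≥ 1`, all of which have positive total degree (`τ` has bidegree `(0,1)`), so its part of positive
total degree acts through linear combinations of non-empty words in the generators.
For `τ = 0` the first generator acts by zero and this is the image of `A^♯_+`. -/
def steenrodPlus : NonUnitalSubalgebra B (Module.End B (Mot B τ n)) :=
  NonUnitalAlgebra.adjoin B
    ({τ • (1 : Module.End B (Mot B τ n)), Q₀ B τ n} ∪ {f | ∃ a : ℕ, 1 ≤ a ∧ f = P B τ n a})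

/-- The hit elements: the span of all `a · u` with `a` of positive total degree. -/
def hit : Submodule B (Mot B τ n) :=
  Submodule.span B {w | ∃ a ∈ steenrodPlus B τ n, ∃ u, w = a u}

/-- Index type of the monomials `x_S y^e`, `S ⊆ {1,…,n}` and `e ∈ ℕⁿ`. -/
abbrev Mono (n : ℕ) : Type := Finset (Fin n) × (Fin n → ℕ)

variable {n} in
/-- The monomial `∏_{i ∈ S} xᵢ · ∏ᵢ yᵢ^{eᵢ}`. -/
def mon (z : Mono n) : Mot B τ n := (∏ i ∈ z.1, x B τ n i) * ∏ i, y B τ n i ^ z.2 i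

/-- The part of topological degree `d` (and arbitrary weight); `τ` has topological degree `0`. -/
def degreePart (d : ℕ) : Submodule B (Mot B τ n) :=
  Submodule.span B {u | ∃ z : Mono n, z.1.card + 2 * ∑ i, z.2 i = d ∧ u = mon B τ z}

/-- The hit quotient in topological degree `d`. -/
abbrev HitQuotient (d : ℕ) : Type :=
  degreePart B τ n d ⧸ (hit B τ n).submoduleOf (degreePart B τ n d)

/-- The exponents of the translate `σ(z_k)`: the exponent of `y_{σ(j)}` is `2^k - 2^{k-j} - 1` for
`j = 1,…,k` (the index `j : Fin k` below is shifted by one), and the exponent of `yᵢ` is `2^k - 1`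
for `i` outside the image of `σ`; the exterior factors are `x_{σ(1)} ⋯ x_{σ(k)}`. -/
def zMono {n k : ℕ} (σ : Fin k ↪o Fin n) : Mono n :=
  (Finset.univ.map σ.toEmbedding,
    Function.extend σ (fun j : Fin k => 2 ^ k - 2 ^ (k - ((j : ℕ) + 1)) - 1) (fun _ => 2 ^ k - 1))

end Ring

/-- The ring `Mₙ = 𝔽₂[τ,x₁,…,xₙ,y₁,…,yₙ]/(xᵢ² + τ yᵢ)`. -/
abbrev M (n : ℕ) : Type := Mot (Polynomial (ZMod 2)) Polynomial.X n

/-- The ring `Nₙ = Mₙ/(τ) = Λ(x₁,…,xₙ) ⊗ 𝔽₂[y₁,…,yₙ]`. -/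
abbrev N (n : ℕ) : Type := Mot (ZMod 2) 0 n

/-! ### Weights and the subspace `Gₙ` -/

section Weights

variable {n : ℕ}

/-- `α_i(z)`: the number of binary digits `1` of `ε_i + 2 e_i`. -/
def α (z : Mono n) (i : Fin n) : ℕ :=
  (Nat.digits 2 ((if i ∈ z.1 then 1 else 0) + 2 * z.2 i)).sum

/-- `ω_j(z)`: the number of `i` such that `ε_i + 2 e_i` has a `1` in the `2^j` place. -/
def ω (z : Mono n) (j : ℕ) : ℕ :=
  (Finset.univ.filter fun i : Fin n =>
    ((if i ∈ z.1 then 1 else 0) + 2 * z.2 i).testBit j = true).card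

end Weights

section Top

variable (n k : ℕ)

/-- The subspace `Yₙ = 𝔽₂[y₁,…,yₙ]` of `Nₙ`. -/
def Y : Submodule (ZMod 2) (N n) :=
  Submodule.span (ZMod 2) (Set.range fun e : Fin n → ℕ => mon (ZMod 2) 0 (∅, e))

/-- The part of `Yₙ` of polynomial degree `b`, that is, of topological degree `2b`. -/
def YPart (b : ℕ) : Submodule (ZMod 2) (N n) :=
  Submodule.span (ZMod 2)
    {u | ∃ e : Fin n → ℕ, ∑ i, e i = b ∧ u = mon (ZMod 2) 0 (∅, e)}

/-- The operators given by the positive-degree part of the subalgebra of reduced powers. -/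
def reducedPlus : NonUnitalSubalgebra (ZMod 2) (Module.End (ZMod 2) (N n)) :=
  NonUnitalAlgebra.adjoin (ZMod 2) {f | ∃ a : ℕ, 1 ≤ a ∧ f = P (ZMod 2) 0 n a}

/-- The subspace `Gₙ ⊆ Yₙ` spanned by `P⁺(Yₙ)` and the monomials `y^e` such that
`(ω₁,…,ω_k) < (n-1,…,n-1)` lexicographically. -/
def G : Submodule (ZMod 2) (N n) :=
  Submodule.span (ZMod 2)
    ({w | ∃ p ∈ reducedPlus n, ∃ f ∈ Y n, w = p f} ∪
      {w | ∃ e : Fin n → ℕ,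
        toLex (fun j : Fin k => ω ((∅, e) : Mono n) ((j : ℕ) + 1)) < toLex (fun _ => n - 1) ∧
        w = mon (ZMod 2) 0 (∅, e)})

/-- `d₁ = (n-1)(2^k-1)`. -/
def dOne : ℕ := (n - 1) * (2 ^ k - 1)

/-- The indices of the monomials of `Λₙᵏ ⊗ Yₙ^{2d₁}`. -/
abbrev TopMono : Type := {z : Mono n // z.1.card = k ∧ ∑ i, z.2 i = dOne n k}

/-- The subspace `Λₙᵏ ⊗ Yₙ^{2d₁}` of `Nₙ`. -/
def topPart : Submodule (ZMod 2) (N n) :=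
  Submodule.span (ZMod 2) (Set.range fun z : TopMono n k => mon (ZMod 2) 0 z.1)

/-- The subspace `Λₙᵏ ⊗ Gₙ^{2d₁}` of `Nₙ`. -/
def topG : Submodule (ZMod 2) (N n) :=
  Submodule.span (ZMod 2)
    {w | ∃ S : Finset (Fin n), S.card = k ∧ ∃ g ∈ G n k ⊓ YPart n (dOne n k),
      w = (∏ i ∈ S, x (ZMod 2) 0 n i) * g}

/-- `Λₙᵏ ⊗ (Yₙ/Gₙ)^{2d₁}`, as the quotient of `Λₙᵏ ⊗ Yₙ^{2d₁}` by `Λₙᵏ ⊗ Gₙ^{2d₁}`. -/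
abbrev TopQuot : Type := topPart n k ⧸ (topG n k).submoduleOf (topPart n k)

/-- The quotient map `π : Λₙᵏ ⊗ Yₙ^{2d₁} → Λₙᵏ ⊗ (Yₙ/Gₙ)^{2d₁}`. -/
def π : topPart n k →ₗ[ZMod 2] TopQuot n k := Submodule.mkQ _

/-- The projection of `Nₙ = ⨁ₐ Λₙᵃ ⊗ Yₙ` onto the summand `a = k`: the coefficient of `sᵏ` in the
image under the algebra map `xᵢ ↦ s xᵢ`, `yᵢ ↦ yᵢ`. -/
def exteriorPart : N n →ₗ[ZMod 2] N n :=
  (Polynomial.lcoeff (N n) k).restrictScalars (ZMod 2) ∘ₗ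
    (Mot.lift (ZMod 2) 0 n
      (fun i => Polynomial.C (x (ZMod 2) 0 n i) * Polynomial.X)
      (fun i => Polynomial.C (y (ZMod 2) 0 n i))
      (by
        intro i
        have h := x_sq (ZMod 2) 0 n i
        rw [map_zero, zero_mul, add_zero] at h
        rw [map_zero, zero_mul, add_zero, mul_pow, ← map_pow, h, map_zero, zero_mul])).toLinearMap

lemma exteriorPart_mon (z : Mono n) :
    exteriorPart n k (mon (ZMod 2) 0 z) = if z.1.card = k then mon (ZMod 2) 0 z else 0 := by
  simp only [exteriorPart, mon, LinearMap.comp_apply, AlgHom.toLinearMap_apply, map_mul, map_prod,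
    map_pow, Mot.lift_x, Mot.lift_y, Finset.prod_mul_distrib, Finset.prod_const,
    LinearMap.restrictScalars_apply, Polynomial.lcoeff_apply]
  simp only [← map_prod, ← map_pow]
  rw [mul_right_comm, ← map_mul, Polynomial.coeff_C_mul, Polynomial.coeff_X_pow]
  by_cases h : z.1.card = k
  · rw [if_pos h, if_pos h.symm, mul_one]
  · rw [if_neg h, if_neg (Ne.symm h), mul_zero]

lemma exteriorPart_mem (u : N n) (hu : u ∈ degreePart (ZMod 2) 0 n (k + 2 * dOne n k)) :
    exteriorPart n k u ∈ topPart n k := by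
  refine Submodule.span_induction (p := fun u _ => exteriorPart n k u ∈ topPart n k)
    ?_ ?_ ?_ ?_ hu
  · rintro _ ⟨z, hz, rfl⟩
    rw [exteriorPart_mon]
    split_ifs with h
    · exact Submodule.subset_span ⟨⟨z, h, by omega⟩, rfl⟩
    · exact zero_mem _
  · rw [map_zero]; exact zero_mem _
  · intro a b _ _ ha hb; rw [map_add]; exact add_mem ha hb
  · intro c a _ ha; rw [map_smul]; exact Submodule.smul_mem _ c ha

/-- The projection `pr_k : Nₙ^{d,*} → Λₙᵏ ⊗ Yₙ^{2d₁}`, where `d = k + 2 d₁`. -/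
def pr : degreePart (ZMod 2) 0 n (k + 2 * dOne n k) →ₗ[ZMod 2] topPart n k :=
  (exteriorPart n k).restrict (exteriorPart_mem n k)

/-- The image under `π` of a monomial of `Λₙᵏ ⊗ Yₙ^{2d₁}`. -/
def πMon (z : TopMono n k) : TopQuot n k :=
  π n k ⟨mon (ZMod 2) 0 z.1, Submodule.subset_span ⟨z, rfl⟩⟩

end Top

section Block

variable {n k : ℕ}

lemma zMono_mem (σ : Fin k ↪o Fin n) :
    (zMono σ).1.card = k ∧ ∑ i, (zMono σ).2 i = dOne n k := by
  refine ⟨by simp [zMono], ?_⟩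
  have hpt : ∀ i, (zMono σ).2 i + ∑ j : Fin k, (if σ j = i then 2 ^ (k - ((j : ℕ) + 1)) else 0)
      = 2 ^ k - 1 := by
    intro i
    by_cases h : ∃ j, σ j = i
    · obtain ⟨j, rfl⟩ := h
      have h1 : (2 : ℕ) ^ (k - ((j : ℕ) + 1)) < 2 ^ k :=
        Nat.pow_lt_pow_right (by norm_num) (by have := j.2; omega)
      have h2 : (zMono σ).2 (σ j) = 2 ^ k - 2 ^ (k - ((j : ℕ) + 1)) - 1 :=
        σ.injective.extend_apply
          (fun j : Fin k => 2 ^ k - 2 ^ (k - ((j : ℕ) + 1)) - 1) (fun _ => 2 ^ k - 1) j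
      simp only [h2, σ.injective.eq_iff, Finset.sum_ite_eq', Finset.mem_univ, if_true]
      generalize 2 ^ (k - ((j : ℕ) + 1)) = p at h1 ⊢
      generalize 2 ^ k = q at h1 ⊢
      omega
    · have h2 : (zMono σ).2 i = 2 ^ k - 1 := Function.extend_apply'
        (fun j : Fin k => 2 ^ k - 2 ^ (k - ((j : ℕ) + 1)) - 1) (fun _ => 2 ^ k - 1) i h
      rw [h2, Finset.sum_eq_zero fun j _ => if_neg fun hj => h ⟨j, hj⟩, add_zero]
  have hgeom : ∑ j : Fin k, 2 ^ (k - ((j : ℕ) + 1)) = 2 ^ k - 1 := by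
    rw [Fin.sum_univ_eq_sum_range (fun j => 2 ^ (k - (j + 1))) k,
      Finset.sum_congr rfl fun j _ => (by rw [Nat.sub_sub, add_comm] :
        2 ^ (k - (j + 1)) = 2 ^ (k - 1 - j)),
      Finset.sum_range_reflect (fun j => 2 ^ j) k, Nat.geomSum_eq (le_refl 2) k]
    simp
  have hsum := Finset.sum_congr (rfl : (Finset.univ : Finset (Fin n)) = _) fun i _ => hpt i
  rw [Finset.sum_add_distrib, Finset.sum_comm] at hsum
  simp only [Finset.sum_ite_eq, Finset.mem_univ, if_true, hgeom, Finset.sum_const,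
    Finset.card_univ, Fintype.card_fin, smul_eq_mul] at hsum
  rw [dOne, Nat.sub_mul, one_mul]
  omega

/-- The translate `σ(z_k)` as an element of `M₁`. -/
def mOne (σ : Fin k ↪o Fin n) : TopMono n k := ⟨zMono σ, zMono_mem σ⟩

/-- `V`, the span of `π(M₁)`, where `M₁` is the set of the `σ(z_k)`. -/
def V (n k : ℕ) : Submodule (ZMod 2) (TopQuot n k) :=
  Submodule.span (ZMod 2) (Set.range fun σ : Fin k ↪o Fin n => πMon n k (mOne σ))

/-- `U₀`, the span of `π(M₀)`. -/
def U₀ (M₀ : Set (TopMono n k)) : Submodule (ZMod 2) (TopQuot n k) :=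
  Submodule.span (ZMod 2) (Set.range fun z : M₀ => πMon n k z.1)

/-- `M₀` is a set of monomials with `α_i(z) < k` for some `i`, such that the images under `π` of the
monomials in `M₀` and of the `σ(z_k)` form a basis of `Λₙᵏ ⊗ (Yₙ/Gₙ)^{2d₁}`. -/
structure IsComplementaryBlock (M₀ : Set (TopMono n k)) : Prop where
  alpha_lt : ∀ z ∈ M₀, ∃ i, α z.1 i < k
  linearIndependent : LinearIndependent (ZMod 2)
    (Sum.elim (fun z : M₀ => πMon n k z.1) (fun σ : Fin k ↪o Fin n => πMon n k (mOne σ)))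
  span_eq_top : Submodule.span (ZMod 2) (Set.range
    (Sum.elim (fun z : M₀ => πMon n k z.1) (fun σ : Fin k ↪o Fin n => πMon n k (mOne σ)))) = ⊤

namespace IsComplementaryBlock

variable {M₀ : Set (TopMono n k)}

lemma isCompl (h : IsComplementaryBlock M₀) : IsCompl (V n k) (U₀ M₀) := by
  obtain ⟨-, -, hd⟩ := linearIndependent_sum.mp h.linearIndependent
  refine ⟨hd.symm, codisjoint_iff.mpr ?_⟩
  rw [sup_comm, ← h.span_eq_top, Set.Sum.elim_range, Submodule.span_union]
  rfl

lemma linearIndependent_mOne (h : IsComplementaryBlock M₀) :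
    LinearIndependent (ZMod 2) (fun σ : Fin k ↪o Fin n => πMon n k (mOne σ)) :=
  (linearIndependent_sum.mp h.linearIndependent).2.1

/-- The local top-layer projection `ϑ = p_{M₁} ∘ π ∘ pr_k : Nₙ^{d,*} → V`, where `p_{M₁}` is the
projection onto `V` with kernel `U₀`. -/
def ϑ (h : IsComplementaryBlock M₀) :
    degreePart (ZMod 2) 0 n (k + 2 * dOne n k) →ₗ[ZMod 2] V n k :=
  Submodule.projectionOnto (V n k) (U₀ M₀) h.isCompl ∘ₗ π n k ∘ₗ pr n k

/-- The parity functional `ε : V → 𝔽₂`, the sum of the coordinates with respect to the basis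
`π(σ(z_k))` of `V`. -/
def ε (h : IsComplementaryBlock M₀) : V n k →ₗ[ZMod 2] ZMod 2 := (Module.Basis.span h.linearIndependent_mOne).sumCoords

end IsComplementaryBlock

end Block

end MotivicHit
end

noncomputable section

namespace MotivicHit

variable {n k : ℕ}

/-! ### Binary digits and binomial coefficients modulo two -/

/-! A word `w` of length `k` in the indices has an exponent vector `wordExp w`: in the place `2^j`,
`j < k`, the binary digit is missing exactly for the index `w j`. Each `σ(z_k)` is a monomial `x_S
y^(wordExp w)` with `w` injective and with set of letters `S`; it picks one order of the letters for
each `S` with `k` elements. For each `S`, `wordFunctional k S` adds up the coefficients of `x_S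
y^(wordExp w)` over all orders of the letters, and `parity` is the sum of these functionals over all
`S`.

Every `wordFunctional k S` kills the image of `P^a`, `a ≥ 1`: if a monomial contributes to a word
monomial, then it has equal exponents at two letters, and the transposition of these letters pairs
off the contributions (`wordFunctional_P_mon`). The Bockstein of a monomial contains either no word
monomial or exactly two, for words that differ by a replacement of the first letter
(`wordFunctional_Q₀`); so `parity` kills its image. The functionals also vanish on `Gₙ` with
exterior factors and on monomials with some `α_i < k`. Hence, for any choice of `M₀`, they give the
coordinates of `ϑ`, and `ε ∘ ϑ` is `parity` (`ε_ϑ`). This puts the image of the hit elements into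
the kernel of `ε`. Conversely, the Bockstein realises the difference of two basis vectors whose sets
of letters differ by one exchange, and such differences span the kernel.

For the existence of `M₀`, a monomial with all `α_i ≥ k` is either zero modulo `Gₙ` or a word
monomial with injective `w`; the operation `P^(2^j)` identifies, modulo `Gₙ`, words that differ by a
swap of adjacent letters. The statement in `Mₙ` follows by reduction modulo `τ`. -/

lemma odd_choose_iff (g h : ℕ) :
    Odd (g.choose h) ↔ (h % 2 = 1 → g % 2 = 1) ∧ Odd ((g / 2).choose (h / 2)) := by
  have h1 := Choose.choose_modEq_choose_mod_mul_choose_div_nat (n := g) (k := h) (p := 2)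
  have h2 : Odd (g.choose h) ↔ Odd ((g % 2).choose (h % 2) * (g / 2).choose (h / 2)) := by
    rw [Nat.odd_iff, Nat.odd_iff, h1]
  rw [h2, Nat.odd_mul]
  refine and_congr_left fun _ => ?_
  rcases Nat.mod_two_eq_zero_or_one g with hg | hg <;>
    rcases Nat.mod_two_eq_zero_or_one h with hh | hh <;> simp [hg, hh]

lemma testBit_of_odd_choose {g h : ℕ} (hc : Odd (g.choose h)) (j : ℕ) (hj : h.testBit j = true) :
    g.testBit j = true := by
  induction j generalizing g h with
  | zero =>
    rw [Nat.testBit_zero, decide_eq_true_eq] at hj ⊢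
    exact ((odd_choose_iff g h).1 hc).1 hj
  | succ j ih =>
    rw [Nat.testBit_succ] at hj ⊢
    exact ih ((odd_choose_iff g h).1 hc).2 hj

lemma odd_choose_two_pow {g j : ℕ} (hj : g.testBit j = true) : Odd (g.choose (2 ^ j)) := by
  induction j generalizing g with
  | zero =>
    rw [Nat.testBit_zero, decide_eq_true_eq] at hj
    simpa [Nat.odd_iff] using hj
  | succ j ih =>
    rw [Nat.testBit_succ] at hj
    rw [odd_choose_iff, pow_succ, Nat.mul_div_cancel _ two_pos]
    exact ⟨fun h => by omega, ih hj⟩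

/-- By Lucas the digits of `h` are among those of `g`. The sum is odd, so `h` is even and `g` odd,
and halving repeats the argument. -/
lemma eq_zero_of_odd_choose {k g h : ℕ} (hs : g + h = 2 ^ k - 1) (hc : Odd (g.choose h)) :
    h = 0 := by
  induction k generalizing g h with
  | zero => simp at hs; exact hs.2
  | succ k ih =>
    have hp : 0 < 2 ^ k := by positivity
    rw [pow_succ] at hs
    obtain ⟨h1, h2⟩ := (odd_choose_iff g h).1 hc
    have := ih (by omega) h2
    omega

/-- Removing such an `h` from a number with one missing digit only moves the gap upwards: `h` is a
run of digits from the place `2^j` up to, but excluding, the new gap `2^m`. In the lowest place with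
`j = 0`, either both numbers are odd and the gap moves on, or both are even and `h` vanishes. -/
lemma exists_of_odd_choose {k j g h : ℕ} (hj : j < k) (hs : g + h + 2 ^ j = 2 ^ k - 1)
    (hc : Odd (g.choose h)) : ∃ m < k, g + 2 ^ m = 2 ^ k - 1 := by
  induction k generalizing j g h with
  | zero => omega
  | succ k ih =>
    have hp : 0 < 2 ^ k := by positivity
    rw [pow_succ] at hs ⊢
    obtain ⟨h1, h2⟩ := (odd_choose_iff g h).1 hc
    obtain _ | j := j
    · by_cases hh : h % 2 = 1
      · have hk : k ≠ 0 := by rintro rfl; omega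
        obtain ⟨m, hm, hm'⟩ := ih (j := 0) (by omega) (by omega) h2
        exact ⟨m + 1, by omega, by rw [pow_succ]; omega⟩
      · have := eq_zero_of_odd_choose (k := k) (by omega) h2
        exact ⟨0, by omega, by omega⟩
    · rw [pow_succ] at hs
      obtain ⟨m, hm, hm'⟩ := ih (j := j) (by omega) (by omega) h2
      exact ⟨m + 1, by omega, by rw [pow_succ]; omega⟩

lemma ofBits_eq_sum {k : ℕ} (f : Fin k → Bool) :
    Nat.ofBits f = ∑ j, if f j = true then 2 ^ (j : ℕ) else 0 := by
  induction k with
  | zero => simp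
  | succ k ih =>
    rw [Nat.ofBits_succ, ih, Fin.sum_univ_succ, Finset.mul_sum, add_comm]
    congr 1
    · cases f 0 <;> rfl
    · refine Finset.sum_congr rfl fun j _ => ?_
      simp [pow_succ, mul_comm]

lemma digits_sum_bit (e : ℕ) (b : ℕ) (hb : b < 2) :
    (Nat.digits 2 (b + 2 * e)).sum = b + (Nat.digits 2 e).sum := by
  by_cases h : b = 0 ∧ e = 0
  · simp [h.1, h.2]
  · rw [Nat.digits_add 2 (by norm_num) b e hb (by omega), List.sum_cons]

lemma digits_sum_ofBits {k : ℕ} (f : Fin k → Bool) :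
    (Nat.digits 2 (Nat.ofBits f)).sum = (Finset.univ.filter fun j => f j = true).card := by
  induction k with
  | zero => simp
  | succ k ih =>
    rw [Nat.ofBits_succ, add_comm, digits_sum_bit _ _ (Bool.toNat_lt _), ih, Finset.card_filter,
      Finset.card_filter, Fin.sum_univ_succ]
    congr 1
    cases f 0 <;> rfl

/-! ### Exponents with one digit missing in each place -/

/-- The exponents whose binary digit in the place `2^j`, `j < k`, is missing exactly for the
index `w j`. -/
def wordExp (w : Fin k → Fin n) (i : Fin n) : ℕ := Nat.ofBits fun j => decide (w j ≠ i)

lemma testBit_wordExp (w : Fin k → Fin n) (i : Fin n) (j : Fin k) :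
    (wordExp w i).testBit j = decide (w j ≠ i) := by
  rw [wordExp, Nat.testBit_ofBits_lt _ _ j.2]

lemma wordExp_injective : Function.Injective (wordExp : (Fin k → Fin n) → Fin n → ℕ) := by
  intro w v h
  funext j
  have := testBit_wordExp w (v j) j
  rw [h, testBit_wordExp] at this
  simpa using this.symm

lemma wordExp_comp (p : Equiv.Perm (Fin n)) (w : Fin k → Fin n) (i : Fin n) :
    wordExp (p ∘ w) (p i) = wordExp w i := by
  simp [wordExp]

lemma wordExp_add_sum (w : Fin k → Fin n) (i : Fin n) :
    wordExp w i + ∑ j : Fin k, (if w j = i then 2 ^ (j : ℕ) else 0) = 2 ^ k - 1 := by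
  have hg : 2 ^ k - 1 = ∑ j : Fin k, 2 ^ (j : ℕ) := by
    rw [Fin.sum_univ_eq_sum_range (fun j => 2 ^ j) k, Nat.geomSum_eq (le_refl 2) k]
    simp
  rw [wordExp, ofBits_eq_sum, ← Finset.sum_add_distrib, hg]
  refine Finset.sum_congr rfl fun j _ => ?_
  by_cases h : w j = i <;> simp [h]

lemma wordExp_apply {w : Fin k → Fin n} (hw : Function.Injective w) (j : Fin k) :
    wordExp w (w j) + 2 ^ (j : ℕ) = 2 ^ k - 1 := by
  rw [← wordExp_add_sum w (w j)]
  simp [hw.eq_iff]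

lemma wordExp_of_notMem {w : Fin k → Fin n} {i : Fin n} (hi : ∀ j, w j ≠ i) :
    wordExp w i = 2 ^ k - 1 := by
  rw [← wordExp_add_sum w i]
  simp [hi]

lemma sum_wordExp (w : Fin k → Fin n) : ∑ i, wordExp w i = dOne n k := by
  have h := Finset.sum_congr (rfl : (Finset.univ : Finset (Fin n)) = _) fun i _ =>
    wordExp_add_sum w i
  rw [Finset.sum_add_distrib, Finset.sum_comm (f := fun i j => if w j = i then _ else _)] at h
  simp only [Finset.sum_ite_eq, Finset.mem_univ, if_true, Finset.sum_const, Finset.card_univ,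
    Fintype.card_fin, smul_eq_mul] at h
  rw [Fin.sum_univ_eq_sum_range (fun j => 2 ^ j) k, Nat.geomSum_eq (le_refl 2) k] at h
  rw [dOne, Nat.sub_mul, one_mul]
  simp at h
  omega

/-- The number of indices whose exponent has a binary digit `1` in the place `2^j`. -/
def bitCount (e : Fin n → ℕ) (j : ℕ) : ℕ :=
  (Finset.univ.filter fun i => (e i).testBit j = true).card

lemma omega_succ (e : Fin n → ℕ) (j : ℕ) : ω ((∅, e) : Mono n) (j + 1) = bitCount e j := by
  simp [ω, bitCount, Nat.testBit_succ]

lemma bitCount_eq_iff {e : Fin n → ℕ} {j : ℕ} (hn : 1 ≤ n) :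
    bitCount e j = n - 1 ↔ ∃ i₀, ∀ i, (e i).testBit j = decide (i₀ ≠ i) := by
  have h1 := Finset.card_filter_add_card_filter_not (s := (Finset.univ : Finset (Fin n)))
    (fun i => (e i).testBit j = true)
  rw [Finset.card_univ, Fintype.card_fin] at h1
  have h2 : bitCount e j = n - 1 ↔
      (Finset.univ.filter fun i => ¬ (e i).testBit j = true).card = 1 := by
    rw [bitCount]; omega
  rw [h2, Finset.card_eq_one]
  refine exists_congr fun a => ?_
  rw [Finset.ext_iff]
  refine forall_congr' fun i => ?_
  simp only [Finset.mem_filter, Finset.mem_univ, true_and, Finset.mem_singleton]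
  by_cases h : a = i
  · simp [h]
  · have h' : i ≠ a := fun h' => h h'.symm
    simp [h, h']

lemma bitCount_wordExp (hn : 1 ≤ n) (w : Fin k → Fin n) (j : Fin k) :
    bitCount (wordExp w) j = n - 1 :=
  (bitCount_eq_iff hn).2 ⟨w j, fun i => testBit_wordExp w i j⟩

/-- The number of odd exponents is at most `n` and has the parity of `n - 1`, because `dOne n (k +
1) = (n - 1) + 2 * dOne n k`; so it cannot exceed `n - 1`. If it equals `n - 1`, halving all
exponents leaves the same problem for `k`. -/
lemma lower_or_bitCount (e : Fin n → ℕ) (he : ∑ i, e i = dOne n k) :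
    (∃ j < k, (∀ i < j, bitCount e i = n - 1) ∧ bitCount e j < n - 1) ∨
      ((∀ j < k, bitCount e j = n - 1) ∧ ∀ i, e i < 2 ^ k) := by
  induction k generalizing e with
  | zero =>
    right
    simp [dOne] at he
    simp [he]
  | succ k ih =>
    have hp : 0 < 2 ^ k := by positivity
    have h0 : bitCount e 0 = ∑ i, e i % 2 := by
      rw [bitCount, Finset.card_filter]
      refine Finset.sum_congr rfl fun i _ => ?_
      rw [Nat.testBit_zero]
      rcases Nat.mod_two_eq_zero_or_one (e i) with h | h <;> simp [h]
    have hsum : ∑ i, e i = bitCount e 0 + 2 * ∑ i, e i / 2 := by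
      rw [h0, Finset.mul_sum, ← Finset.sum_add_distrib]
      exact Finset.sum_congr rfl fun i _ => (Nat.mod_add_div _ _).symm
    have hle : bitCount e 0 ≤ n := by
      rw [bitCount]
      exact (Finset.card_le_univ _).trans (by simp)
    have hd : dOne n (k + 1) = (n - 1) + 2 * dOne n k := by
      have : 2 ^ (k + 1) - 1 = 1 + 2 * (2 ^ k - 1) := by rw [pow_succ]; omega
      rw [dOne, this, dOne]; ring
    have hs : ∀ j, bitCount e (j + 1) = bitCount (fun i => e i / 2) j := by
      intro j; simp [bitCount, Nat.testBit_succ]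
    rcases lt_trichotomy (bitCount e 0) (n - 1) with hc | hc | hc
    · exact Or.inl ⟨0, by omega, by simp, hc⟩
    · rcases ih (fun i => e i / 2) (by omega) with ⟨j, hj, h1, h2⟩ | ⟨h1, h2⟩
      · refine Or.inl ⟨j + 1, by omega, ?_, by rw [hs]; exact h2⟩
        rintro (_ | i) hi
        · exact hc
        · rw [hs]; exact h1 i (by omega)
      · refine Or.inr ⟨?_, fun i => ?_⟩
        · rintro (_ | i) hi
          · exact hc
          · rw [hs]; exact h1 i (by omega)
        · have := h2 i
          rw [pow_succ]; omega
    · omega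

/-- A place counted `n - 1` times is missing for a single index; that index is the letter of the
word. -/
lemma lower_or_eq_wordExp (hn : 1 ≤ n) (e : Fin n → ℕ) (he : ∑ i, e i = dOne n k) :
    (∃ j < k, (∀ i < j, bitCount e i = n - 1) ∧ bitCount e j < n - 1) ∨
      ∃ w : Fin k → Fin n, e = wordExp w := by
  refine (lower_or_bitCount e he).imp id fun ⟨h1, h2⟩ => ?_
  choose w hw using fun j : Fin k => (bitCount_eq_iff hn).1 (h1 j j.2)
  refine ⟨w, funext fun i => Nat.eq_of_testBit_eq fun j => ?_⟩
  by_cases hj : j < k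
  · rw [testBit_wordExp w i ⟨j, hj⟩]
    exact hw ⟨j, hj⟩ i
  · rw [wordExp, Nat.testBit_ofBits_ge _ _ (by omega)]
    exact Nat.testBit_eq_false_of_lt ((h2 i).trans_le (Nat.pow_le_pow_right two_pos (by omega)))

/-- Consequently `α_i ≥ k` for all `i` means that no letter is repeated and that all letters lie in
`S`. -/
lemma alpha_wordExp (S : Finset (Fin n)) (w : Fin k → Fin n) (i : Fin n) :
    α (S, wordExp w) i + (Finset.univ.filter fun j => w j = i).card =
      (if i ∈ S then 1 else 0) + k := by
  have h := Finset.card_filter_add_card_filter_not (s := (Finset.univ : Finset (Fin k)))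
    (fun j => w j = i)
  rw [Finset.card_univ, Fintype.card_fin] at h
  rw [α]
  dsimp only
  rw [digits_sum_bit _ _ (by split_ifs <;> norm_num), wordExp, digits_sum_ofBits]
  simp only [decide_eq_true_eq, ne_eq]
  omega

/-! ### The monomial basis of `Nₙ` -/

section Coefficients

/-- The exponent vector of a monomial in the polynomial ring on the `xᵢ` and `yᵢ`. -/
def Mono.toFinsupp (z : Mono n) : Fin n ⊕ Fin n →₀ ℕ :=
  Finsupp.equivFunOnFinite.symm (Sum.elim (fun i => if i ∈ z.1 then 1 else 0) z.2)

lemma Mono.toFinsupp_injective : Function.Injective (Mono.toFinsupp (n := n)) := by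
  rintro ⟨S, e⟩ ⟨T, f⟩ h
  have h' := Finsupp.equivFunOnFinite.symm.injective h
  refine Prod.ext (Finset.ext fun i => ?_) (funext fun i => congrFun h' (Sum.inr i))
  have := congrFun h' (Sum.inl i)
  by_cases h1 : i ∈ S <;> by_cases h2 : i ∈ T <;> simp_all

lemma mk_surjective (B : Type) [CommRing B] (τ : B) : Function.Surjective (Mot.mk B τ n) :=
  Ideal.Quotient.mk_surjective

lemma mk_monomial (z : Mono n) :
    Mot.mk (ZMod 2) 0 n (MvPolynomial.monomial z.toFinsupp 1) = mon (ZMod 2) 0 z := by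
  rw [MvPolynomial.monomial_eq, map_one, one_mul, Finsupp.prod_fintype _ _ (by simp),
    Fintype.prod_sum_type, map_mul, map_prod, map_prod, mon]
  congr 1
  · rw [← Finset.prod_filter_mul_prod_filter_not Finset.univ (fun i => i ∈ z.1)]
    rw [Finset.prod_eq_one (s := Finset.univ.filter fun i => i ∉ z.1), mul_one]
    · refine Finset.prod_congr (by ext; simp) fun i hi => ?_
      simp [Mono.toFinsupp, hi, x]
    · intro i hi
      have : i ∉ z.1 := by simpa using hi
      simp [Mono.toFinsupp, this]

/-- For `τ = 0` the ideal is generated by the `xᵢ²`, none of which divides a monomial with exterior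
exponents at most `1`. This makes the coefficients well defined on `Nₙ`. -/
lemma coeff_eq_zero_of_mk_eq_zero (z : Mono n) (p : MvPolynomial (Fin n ⊕ Fin n) (ZMod 2))
    (hp : Mot.mk (ZMod 2) 0 n p = 0) : p.coeff z.toFinsupp = 0 := by
  obtain ⟨c, rfl⟩ := Ideal.mem_span_range_iff_exists_fun.1 (Ideal.Quotient.eq_zero_iff_mem.1 hp)
  rw [MvPolynomial.coeff_sum]
  refine Finset.sum_eq_zero fun i _ => ?_
  rw [map_zero, zero_mul, add_zero, MvPolynomial.X_pow_eq_monomial,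
    MvPolynomial.coeff_mul_monomial', if_neg]
  intro hle
  have := hle (Sum.inl i)
  simp only [Finsupp.single_eq_same, Mono.toFinsupp, Finsupp.equivFunOnFinite_symm_apply_apply,
    Sum.elim_inl] at this
  split_ifs at this <;> omega

/-- The coefficient of a monomial. -/
def coef (z : Mono n) : N n →ₗ[ZMod 2] ZMod 2 :=
  Submodule.liftQ (LinearMap.ker (Mot.mk (ZMod 2) 0 n).toLinearMap)
    (MvPolynomial.lcoeff (ZMod 2) z.toFinsupp) (fun p hp => coeff_eq_zero_of_mk_eq_zero z p hp) ∘ₗ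
    ((Mot.mk (ZMod 2) 0 n).toLinearMap.quotKerEquivOfSurjective
      (mk_surjective (ZMod 2) 0)).symm.toLinearMap

lemma coef_mk (z : Mono n) (p : MvPolynomial (Fin n ⊕ Fin n) (ZMod 2)) :
    coef z (Mot.mk (ZMod 2) 0 n p) = p.coeff z.toFinsupp := by
  have h := LinearMap.quotKerEquivOfSurjective_symm_apply (Mot.mk (ZMod 2) 0 n).toLinearMap
    (mk_surjective (ZMod 2) 0) p
  rw [AlgHom.toLinearMap_apply] at h
  rw [coef, LinearMap.comp_apply, LinearEquiv.coe_coe, h]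
  rfl

lemma coef_mon (z z' : Mono n) : coef z (mon (ZMod 2) 0 z') = if z' = z then 1 else 0 := by
  rw [← mk_monomial, coef_mk, MvPolynomial.coeff_monomial]
  simp only [Mono.toFinsupp_injective.eq_iff]

lemma mon_mul_y (z : Mono n) (i : Fin n) :
    mon (ZMod 2) 0 z * y (ZMod 2) 0 n i = mon (ZMod 2) 0 (z.1, z.2 + Pi.single i 1) := by
  simp only [mon, Pi.add_apply, pow_add, Finset.prod_mul_distrib]
  rw [mul_assoc]
  congr 2
  rw [Finset.prod_eq_single i (fun j _ hj => by rw [Pi.single_eq_of_ne hj, pow_zero]) (by simp),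
    Pi.single_eq_same, pow_one]

lemma span_mon : Submodule.span (ZMod 2) (Set.range (mon (n := n) (ZMod 2) 0)) = ⊤ := by
  rw [eq_top_iff]
  rintro u -
  obtain ⟨p, rfl⟩ := mk_surjective (ZMod 2) 0 u
  induction p using MvPolynomial.induction_on with
  | C a =>
    rw [← MvPolynomial.algebraMap_eq, AlgHom.commutes, Algebra.algebraMap_eq_smul_one]
    refine Submodule.smul_mem _ _ (Submodule.subset_span ⟨(∅, 0), ?_⟩)
    simp [mon]
  | add p q hp hq => rw [map_add]; exact add_mem hp hq
  | mul_X p i hp =>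
    rw [map_mul]
    refine Submodule.span_induction
      (p := fun u _ => u * Mot.mk (ZMod 2) 0 n (MvPolynomial.X i) ∈ _) ?_ (by simp)
      (fun a b _ _ ha hb => by rw [add_mul]; exact add_mem ha hb)
      (fun c a _ ha => by rw [smul_mul_assoc]; exact Submodule.smul_mem _ c ha) hp
    rintro _ ⟨z, rfl⟩
    obtain i | i := i
    · change mon (ZMod 2) 0 z * x (ZMod 2) 0 n i ∈ _
      by_cases hi : i ∈ z.1
      · have h2 := x_sq (ZMod 2) 0 n i
        rw [map_zero, zero_mul, add_zero] at h2
        have : mon (ZMod 2) 0 z * x (ZMod 2) 0 n i = 0 := by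
          rw [mon, ← Finset.mul_prod_erase _ _ hi]
          linear_combination (∏ j ∈ z.1.erase i, x (ZMod 2) 0 n j) *
            (∏ j, y (ZMod 2) 0 n j ^ z.2 j) * h2
        rw [this]; exact zero_mem _
      · refine Submodule.subset_span ⟨(insert i z.1, z.2), ?_⟩
        rw [mon, mon, Finset.prod_insert hi]
        ring
    · exact Submodule.subset_span ⟨_, (mon_mul_y z i).symm⟩

lemma linearMap_ext_mon {A : Type} [AddCommGroup A] [Module (ZMod 2) A] {f g : N n →ₗ[ZMod 2] A}
    (h : ∀ z : Mono n, f (mon (ZMod 2) 0 z) = g (mon (ZMod 2) 0 z)) : f = g :=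
  LinearMap.ext_on_range span_mon h

end Coefficients

/-! ### The operations on monomials -/

section Operations

/-- The homomorphism `u ↦ ∑ₐ Pᵃ(u) tᵃ` is the part of the total operation free of `s`. -/
def reHom (n : ℕ) : TotalTarget (ZMod 2) 0 n →+* Polynomial (N n) where
  toFun q := q.re
  map_one' := rfl
  map_zero' := rfl
  map_add' _ _ := rfl
  map_mul' p q := by simp [QuadraticAlgebra.re_mul]

lemma reHom_total_mon (z : Mono n) :
    reHom n (total (ZMod 2) 0 n (mon (ZMod 2) 0 z)) =
      Polynomial.C (∏ i ∈ z.1, x (ZMod 2) 0 n i) * ∏ i, (Polynomial.C (y (ZMod 2) 0 n i) +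
        Polynomial.C (y (ZMod 2) 0 n i ^ 2) * Polynomial.X) ^ z.2 i := by
  simp only [mon, map_mul, map_prod, map_pow, total, Mot.lift_x, Mot.lift_y]
  rfl

lemma P_apply (a : ℕ) (u : N n) :
    P (ZMod 2) 0 n a u = (reHom n (total (ZMod 2) 0 n u)).coeff a := rfl

/-- For `τ = 0` the correction term of the Cartan formula disappears and `Pᵃ xᵢ = 0` for `a ≥ 1`, so
the reduced powers are linear over the exterior algebra. -/
lemma P_prod_x_mul (a : ℕ) (S : Finset (Fin n)) (u : N n) :
    P (ZMod 2) 0 n a ((∏ i ∈ S, x (ZMod 2) 0 n i) * u) =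
      (∏ i ∈ S, x (ZMod 2) 0 n i) * P (ZMod 2) 0 n a u := by
  have h := reHom_total_mon ((S, 0) : Mono n)
  simp only [mon, Pi.zero_apply, pow_zero, Finset.prod_const_one, mul_one] at h
  rw [P_apply, map_mul, map_mul, h, Polynomial.coeff_C_mul, P_apply]

lemma C_add_pow (e : ℕ) (v : N n) :
    (Polynomial.C v + Polynomial.C (v ^ 2) * Polynomial.X) ^ e =
      ∑ h ∈ Finset.range (e + 1),
        Polynomial.C (((e.choose h : ℕ) : N n) * v ^ (e + h)) * Polynomial.X ^ h := by
  rw [add_comm, add_pow]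
  refine Finset.sum_congr rfl fun h hh => ?_
  have : e + h = 2 * h + (e - h) := by have := Finset.mem_range.1 hh; omega
  rw [this, pow_add, pow_mul, mul_pow]
  simp only [map_mul, map_natCast, map_pow]
  ring

lemma P_mon (a : ℕ) (z : Mono n) :
    P (ZMod 2) 0 n a (mon (ZMod 2) 0 z) =
      ∑ h ∈ Fintype.piFinset fun i => Finset.range (z.2 i + 1),
        if ∑ i, h i = a then
          ((∏ i, (z.2 i).choose (h i) : ℕ) : ZMod 2) • mon (ZMod 2) 0 (z.1, z.2 + h) else 0 := by
  rw [P_apply, reHom_total_mon]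
  simp only [C_add_pow]
  rw [Finset.prod_univ_sum, Polynomial.coeff_C_mul, Polynomial.finsetSum_coeff, Finset.mul_sum]
  refine Finset.sum_congr rfl fun h _ => ?_
  rw [Finset.prod_mul_distrib, Finset.prod_pow_eq_pow_sum, ← map_prod, Polynomial.coeff_C_mul,
    Polynomial.coeff_X_pow]
  by_cases hs : ∑ i, h i = a
  · rw [if_pos hs, if_pos hs.symm, mul_one, Finset.prod_mul_distrib, Algebra.smul_def,
      map_natCast, Nat.cast_prod, mon]
    simp only [Pi.add_apply]
    ring
  · rw [if_neg hs, if_neg (Ne.symm hs), mul_zero, mul_zero]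

lemma P_zero_apply (u : N n) : P (ZMod 2) 0 n 0 u = u := by
  have : P (ZMod 2) 0 n 0 = LinearMap.id := by
    refine linearMap_ext_mon fun z => ?_
    rw [P_apply, reHom_total_mon, Polynomial.coeff_zero_eq_eval_zero]
    simp [Polynomial.eval_prod, mon]
  rw [this, LinearMap.id_apply]

lemma Q₀_mul (u v : N n) :
    Q₀ (ZMod 2) 0 n (u * v) = u * Q₀ (ZMod 2) 0 n v + v * Q₀ (ZMod 2) 0 n u := by
  have hu := P_zero_apply u
  have hv := P_zero_apply v
  change (total (ZMod 2) 0 n u).re.coeff 0 = u at hu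
  change (total (ZMod 2) 0 n v).re.coeff 0 = v at hv
  change (total (ZMod 2) 0 n (u * v)).im.coeff 0 = u * (total (ZMod 2) 0 n v).im.coeff 0 +
    v * (total (ZMod 2) 0 n u).im.coeff 0
  rw [map_mul, QuadraticAlgebra.im_mul]
  simp only [zero_mul, add_zero, Polynomial.coeff_add, Polynomial.mul_coeff_zero, hu, hv]
  ring

/-- The Bockstein as a derivation. -/
def bockstein (n : ℕ) : Derivation (ZMod 2) (N n) (N n) :=
  Derivation.mk' (Q₀ (ZMod 2) 0 n) Q₀_mul

lemma bockstein_x (i : Fin n) : bockstein n (x (ZMod 2) 0 n i) = y (ZMod 2) 0 n i := by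
  change (total (ZMod 2) 0 n (x (ZMod 2) 0 n i)).im.coeff 0 = _
  rw [total, Mot.lift_x, Polynomial.coeff_C_zero]

lemma bockstein_y (i : Fin n) : bockstein n (y (ZMod 2) 0 n i) = 0 := by
  change (total (ZMod 2) 0 n (y (ZMod 2) 0 n i)).im.coeff 0 = _
  rw [total, Mot.lift_y, Polynomial.coeff_zero]

lemma bockstein_prod_x (S : Finset (Fin n)) :
    bockstein n (∏ i ∈ S, x (ZMod 2) 0 n i) =
      ∑ i ∈ S, (∏ j ∈ S.erase i, x (ZMod 2) 0 n j) * y (ZMod 2) 0 n i := by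
  induction S using Finset.induction_on with
  | empty => simp
  | insert a S ha ih =>
    rw [Finset.prod_insert ha, Derivation.leibniz, ih, bockstein_x, Finset.sum_insert ha,
      Finset.erase_insert ha, smul_eq_mul, smul_eq_mul, Finset.mul_sum, add_comm]
    congr 1
    refine Finset.sum_congr rfl fun i hi => ?_
    have hne : a ≠ i := fun h => ha (h ▸ hi)
    rw [Finset.erase_insert_of_ne hne, Finset.prod_insert (by simp [ha])]
    ring

lemma bockstein_prod_y (s : Finset (Fin n)) (e : Fin n → ℕ) :
    bockstein n (∏ i ∈ s, y (ZMod 2) 0 n i ^ e i) = 0 := by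
  induction s using Finset.induction_on with
  | empty => simp
  | insert a s ha ih =>
    rw [Finset.prod_insert ha, Derivation.leibniz, ih, Derivation.leibniz_pow, bockstein_y]
    simp

lemma Q₀_mon (z : Mono n) :
    Q₀ (ZMod 2) 0 n (mon (ZMod 2) 0 z) =
      ∑ i ∈ z.1, mon (ZMod 2) 0 (z.1.erase i, z.2 + Pi.single i 1) := by
  change bockstein n _ = _
  rw [mon, Derivation.leibniz, bockstein_prod_y, bockstein_prod_x, smul_zero, zero_add,
    smul_eq_mul, Finset.mul_sum]
  refine Finset.sum_congr rfl fun i _ => ?_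
  rw [← mon_mul_y (z.1.erase i, z.2) i, mon]
  ring

end Operations

/-! ### The parity functionals -/

/-- The image of a word without repetitions. -/
def letters (w : Fin k ↪ Fin n) : Finset (Fin n) := Finset.univ.map w

lemma mem_letters {w : Fin k ↪ Fin n} {i : Fin n} : i ∈ letters w ↔ ∃ j, w j = i := by
  simp [letters]

lemma card_letters (w : Fin k ↪ Fin n) : (letters w).card = k := by
  simp [letters]

lemma letters_trans (w : Fin k ↪ Fin n) (p : Equiv.Perm (Fin n)) :
    letters (w.trans p.toEmbedding) = (letters w).map p.toEmbedding := by
  rw [letters, letters, Finset.map_map]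

variable (k) in
/-- The sum of the coefficients of the monomials `x_S y^e`, where `e` is the exponent of a word
without repetitions and with set of letters `S`. -/
def wordFunctional (S : Finset (Fin n)) : N n →ₗ[ZMod 2] ZMod 2 :=
  ∑ w : Fin k ↪ Fin n with letters w = S, coef (S, wordExp w)

lemma wordFunctional_apply (S : Finset (Fin n)) (u : N n) :
    wordFunctional k S u = ∑ w : Fin k ↪ Fin n with letters w = S, coef (S, wordExp w) u := by
  rw [wordFunctional, LinearMap.sum_apply]

lemma wordFunctional_eq_zero {S : Finset (Fin n)} {z : Mono n}
    (h : ∀ w : Fin k ↪ Fin n, letters w = z.1 → wordExp w ≠ z.2) :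
    wordFunctional k S (mon (ZMod 2) 0 z) = 0 := by
  rw [wordFunctional_apply]
  refine Finset.sum_eq_zero fun w hw => ?_
  rw [coef_mon, if_neg]
  rintro rfl
  exact h w (Finset.mem_filter.1 hw).2 rfl

lemma wordFunctional_wordExp (S : Finset (Fin n)) (w : Fin k ↪ Fin n) :
    wordFunctional k S (mon (ZMod 2) 0 (letters w, wordExp w)) =
      if letters w = S then 1 else 0 := by
  rw [wordFunctional_apply]
  by_cases h : letters w = S
  · rw [if_pos h, Finset.sum_eq_single w]
    · rw [coef_mon, if_pos (by rw [h])]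
    · intro v _ hv
      rw [coef_mon, if_neg]
      intro hvw
      exact hv (DFunLike.coe_injective (wordExp_injective (congrArg Prod.snd hvw).symm))
    · intro hw
      exact absurd (Finset.mem_filter.2 ⟨Finset.mem_univ w, h⟩) hw
  · rw [if_neg h]
    refine Finset.sum_eq_zero fun v _ => ?_
    rw [coef_mon, if_neg fun hz => h (congrArg Prod.fst hz)]

lemma coef_P_mon (S : Finset (Fin n)) (e : Fin n → ℕ) (a : ℕ) (z : Mono n) :
    coef (S, e) (P (ZMod 2) 0 n a (mon (ZMod 2) 0 z)) =
      if z.1 = S ∧ (∀ i, z.2 i ≤ e i) ∧ ∑ i, (e i - z.2 i) = a then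
        ((∏ i, (z.2 i).choose (e i - z.2 i) : ℕ) : ZMod 2) else 0 := by
  rw [P_mon, map_sum, Finset.sum_eq_single (fun i => e i - z.2 i)]
  · rw [apply_ite (coef (S, e)), map_smul, coef_mon, map_zero]
    have : ((z.1, z.2 + fun i => e i - z.2 i) : Mono n) = (S, e) ↔
        z.1 = S ∧ ∀ i, z.2 i ≤ e i := by
      rw [Prod.mk.injEq, funext_iff]
      refine and_congr_right fun _ => forall_congr' fun i => ?_
      rw [Pi.add_apply]; omega
    simp only [this, ← and_assoc]
    by_cases h1 : z.1 = S ∧ ∀ i, z.2 i ≤ e i <;> by_cases h2 : ∑ i, (e i - z.2 i) = a <;>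
      simp [h1, h2]
  · intro h _ hne
    have hz : ((z.1, z.2 + h) : Mono n) ≠ (S, e) := by
      intro hz
      refine hne (funext fun i => ?_)
      have h2 := congrFun (congrArg Prod.snd hz) i
      simp only [Pi.add_apply] at h2
      omega
    rw [apply_ite (coef (S, e)), map_smul, coef_mon, map_zero, if_neg hz, smul_zero, ite_self]
  -- If `e - z.2` is outside the range of summation, some entry exceeds the exponent it is chosen
  -- from, so the binomial product is zero too.
  · intro hmem
    rw [apply_ite (coef (S, e)), map_smul, map_zero]
    have : ∃ i, (z.2 i).choose (e i - z.2 i) = 0 := by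
      by_contra! hc
      refine hmem (Fintype.mem_piFinset.2 fun i => Finset.mem_range.2 ?_)
      have := hc i
      rw [Ne, Nat.choose_eq_zero_iff] at this
      omega
    obtain ⟨i, hi⟩ := this
    rw [Finset.prod_eq_zero (Finset.mem_univ i) hi, Nat.cast_zero, zero_smul, ite_self]

/-- At a letter, `g` again misses a single digit; elsewhere it equals `2^k - 1`, as `wordExp w`
does. If the values at the letters were distinct, the gaps would permute the `k` places, and `g`
would have the same sum as `wordExp w`. -/
lemma exists_ne_of_odd_choose (w : Fin k ↪ Fin n) (g : Fin n → ℕ) (hg : ∀ i, g i ≤ wordExp w i)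
    (hodd : ∀ i, Odd ((g i).choose (wordExp w i - g i)))
    (hpos : ∑ i, (wordExp w i - g i) ≠ 0) :
    ∃ i ∈ letters w, ∃ i' ∈ letters w, i ≠ i' ∧ g i = g i' := by
  by_contra! hc
  have hm : ∀ j : Fin k, ∃ m : Fin k, g (w j) + 2 ^ (m : ℕ) = 2 ^ k - 1 := by
    intro j
    obtain ⟨m, hm, hm'⟩ := exists_of_odd_choose (k := k) (j := j) (g := g (w j)) j.2 (by
      have := wordExp_apply w.injective j
      have := hg (w j)
      omega) (hodd (w j))
    exact ⟨⟨m, hm⟩, hm'⟩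
  choose m hm using hm
  have hinj : Function.Injective m := by
    intro j j' h
    by_contra hne
    refine hc (w j) (mem_letters.2 ⟨j, rfl⟩) (w j') (mem_letters.2 ⟨j', rfl⟩)
      (fun h' => hne (w.injective h')) ?_
    have h1 := hm j
    have h2 := hm j'
    rw [h] at h1
    omega
  let p : Equiv.Perm (Fin k) := Equiv.ofBijective m (Finite.injective_iff_bijective.1 hinj)
  -- The letter `w j` now misses the place `m j`, which is the exponent of the word `w` with its
  -- places permuted by `p`.
  have hge : g = wordExp (w ∘ p.symm) := by
    funext i
    by_cases hi : ∃ j, w j = i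
    · obtain ⟨j, rfl⟩ := hi
      have h1 := wordExp_apply (w.injective.comp p.symm.injective) (p j)
      rw [Function.comp_apply, Equiv.symm_apply_apply] at h1
      have h2 := hm j
      have h3 : ((p j : Fin k) : ℕ) = m j := rfl
      rw [h3] at h1
      omega
    · push Not at hi
      rw [wordExp_of_notMem (w := w ∘ p.symm) fun j => hi (p.symm j)]
      have h1 := wordExp_of_notMem hi
      have h2 := hodd i
      have h3 := hg i
      rw [h1] at h2 h3
      have := eq_zero_of_odd_choose (k := k) (by omega) h2
      omega
  apply hpos
  rw [Finset.sum_tsub_distrib _ fun i _ => hg i, sum_wordExp, hge, sum_wordExp, Nat.sub_self]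

/-- One nonzero contribution provides two letters `i`, `i'` in `S` at which `z` has equal exponents.
Swapping them fixes the exponents of `z` and preserves every coefficient, but fixes no word with
letters `S`. The contributions therefore cancel in pairs. -/
lemma wordFunctional_P_mon (S : Finset (Fin n)) {a : ℕ} (ha : 1 ≤ a) (z : Mono n) :
    wordFunctional k S (P (ZMod 2) 0 n a (mon (ZMod 2) 0 z)) = 0 := by
  rw [wordFunctional_apply]
  by_cases hall : ∀ w ∈ Finset.univ.filter fun w : Fin k ↪ Fin n => letters w = S,
      coef (S, wordExp w) (P (ZMod 2) 0 n a (mon (ZMod 2) 0 z)) = 0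
  · exact Finset.sum_eq_zero hall
  push Not at hall
  obtain ⟨w, hw, hne⟩ := hall
  obtain rfl := (Finset.mem_filter.1 hw).2
  rw [coef_P_mon] at hne
  obtain ⟨⟨-, hle, hsum⟩, hne⟩ := ite_ne_right_iff.1 hne
  have hodd : ∀ i, Odd ((z.2 i).choose (wordExp w i - z.2 i)) := by
    intro i
    rw [Nat.cast_prod, Finset.prod_ne_zero_iff] at hne
    exact ZMod.natCast_ne_zero_iff_odd.1 (hne i (Finset.mem_univ i))
  obtain ⟨i, hi, i', hi', hii, hz⟩ := exists_ne_of_odd_choose w z.2 hle hodd (by omega)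
  have hzs : ∀ l, z.2 (Equiv.swap i i' l) = z.2 l := by
    intro l
    by_cases h1 : l = i
    · rw [h1, Equiv.swap_apply_left, hz]
    by_cases h2 : l = i'
    · rw [h2, Equiv.swap_apply_right, hz]
    rw [Equiv.swap_apply_of_ne_of_ne h1 h2]
  refine Finset.sum_involution (fun v _ => v.trans (Equiv.swap i i').toEmbedding) ?_ ?_ ?_ ?_
  · intro v _
    have hv : ∀ l, wordExp (v.trans (Equiv.swap i i').toEmbedding) (Equiv.swap i i' l) =
        wordExp v l := fun l => wordExp_comp (Equiv.swap i i') v l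
    have h1 : (∀ l, z.2 l ≤ wordExp (v.trans (Equiv.swap i i').toEmbedding) l) ↔
        ∀ l, z.2 l ≤ wordExp v l := by
      rw [← (Equiv.swap i i').forall_congr_right]
      simp only [hv, hzs]
    have h2 : ∑ l, (wordExp (v.trans (Equiv.swap i i').toEmbedding) l - z.2 l) =
        ∑ l, (wordExp v l - z.2 l) := by
      rw [← Equiv.sum_comp (Equiv.swap i i')]
      simp only [hv, hzs]
    have h3 : ∏ l, (z.2 l).choose (wordExp (v.trans (Equiv.swap i i').toEmbedding) l - z.2 l) =
        ∏ l, (z.2 l).choose (wordExp v l - z.2 l) := by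
      rw [← Equiv.prod_comp (Equiv.swap i i')]
      simp only [hv, hzs]
    simp only [coef_P_mon, h1, h2, h3]
    exact CharTwo.add_self_eq_zero _
  · intro v hv _ heq
    rw [← (Finset.mem_filter.1 hv).2] at hi
    obtain ⟨j, rfl⟩ := mem_letters.1 hi
    have := DFunLike.congr_fun heq j
    rw [Function.Embedding.trans_apply, Equiv.coe_toEmbedding, Equiv.swap_apply_left] at this
    exact hii this.symm
  · intro v hv
    refine Finset.mem_filter.2 ⟨Finset.mem_univ _, ?_⟩
    rw [letters_trans, (Finset.mem_filter.1 hv).2]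
    refine Finset.eq_of_subset_of_card_le (fun l hl => ?_) (by simp)
    obtain ⟨l, hl', rfl⟩ := Finset.mem_map.1 hl
    rw [Equiv.coe_toEmbedding]
    by_cases h1 : l = i
    · rw [h1, Equiv.swap_apply_left]; exact hi'
    by_cases h2 : l = i'
    · rw [h2, Equiv.swap_apply_right]; exact hi
    rw [Equiv.swap_apply_of_ne_of_ne h1 h2]; exact hl'
  · intro v _
    ext l
    simp

lemma wordFunctional_P (S : Finset (Fin n)) {a : ℕ} (ha : 1 ≤ a) (u : N n) :
    wordFunctional k S (P (ZMod 2) 0 n a u) = 0 := by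
  have : wordFunctional k S ∘ₗ P (ZMod 2) 0 n a = 0 :=
    linearMap_ext_mon fun z => wordFunctional_P_mon S ha z
  exact LinearMap.congr_fun this u

/-- The word obtained from `w` by replacing its first letter by `i`. -/
def replaceFirst (hk : 0 < k) (w : Fin k ↪ Fin n) (i : Fin n) : Fin k ↪ Fin n :=
  w.trans (Equiv.swap i (w ⟨0, hk⟩)).toEmbedding

lemma letters_replaceFirst (hk : 0 < k) (w : Fin k ↪ Fin n) {i : Fin n} (hi : i ∉ letters w) :
    letters (replaceFirst hk w i) = (insert i (letters w)).erase (w ⟨0, hk⟩) := by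
  have h0 : w ⟨0, hk⟩ ∈ letters w := mem_letters.2 ⟨_, rfl⟩
  rw [replaceFirst, letters_trans]
  refine Finset.eq_of_subset_of_card_le (fun l hl => ?_) ?_
  · obtain ⟨l, hl', rfl⟩ := Finset.mem_map.1 hl
    rw [Equiv.coe_toEmbedding]
    have h1 : l ≠ i := fun h => hi (h ▸ hl')
    by_cases h2 : l = w ⟨0, hk⟩
    · rw [h2, Equiv.swap_apply_right]
      exact Finset.mem_erase.2 ⟨fun h => hi (h ▸ h0), Finset.mem_insert_self _ _⟩
    · rw [Equiv.swap_apply_of_ne_of_ne h1 h2]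
      exact Finset.mem_erase.2 ⟨h2, Finset.mem_insert_of_mem hl'⟩
  · rw [Finset.card_map, Finset.card_erase_of_mem (Finset.mem_insert_of_mem h0),
      Finset.card_insert_of_notMem hi]
    simp

/-- In `f` the lowest digit is missing at `i` and at the first letter `i₀`. Only raising the
exponent at one of these two leaves a single gap in that place: at `i` this gives back `w`, at `i₀`
it gives `w` with first letter `i`. -/
lemma wordFunctional_Q₀ (hk : 0 < k) (S T : Finset (Fin n)) (f : Fin n → ℕ) (w : Fin k ↪ Fin n)
    {i : Fin n} (hi : i ∉ letters w) (hT : T = insert i (letters w))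
    (hf : f + Pi.single i 1 = wordExp w) :
    wordFunctional k S (Q₀ (ZMod 2) 0 n (mon (ZMod 2) 0 (T, f))) =
      (if letters w = S then 1 else 0) + if letters (replaceFirst hk w i) = S then 1 else 0 := by
  subst hT
  set i₀ := w ⟨0, hk⟩ with hi₀
  have hi₀w : i₀ ∈ letters w := mem_letters.2 ⟨_, rfl⟩
  have hne : i ≠ i₀ := fun h => hi (h ▸ hi₀w)
  have hw' : ∀ l, wordExp (replaceFirst hk w i) (Equiv.swap i i₀ l) = wordExp w l :=
    fun l => wordExp_comp (Equiv.swap i i₀) w l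
  have e1 : wordExp w i = 2 ^ k - 1 := wordExp_of_notMem fun j hj => hi (mem_letters.2 ⟨j, hj⟩)
  have e2 : wordExp w i₀ + 1 = 2 ^ k - 1 := wordExp_apply w.injective ⟨0, hk⟩
  have hfi : f i + 1 = wordExp w i := by rw [← hf]; simp
  have hfl : ∀ l, l ≠ i → f l = wordExp w l := by
    intro l hl; rw [← hf, Pi.add_apply, Pi.single_eq_of_ne hl, add_zero]
  have hf' : f + Pi.single i₀ 1 = wordExp (replaceFirst hk w i) := by
    funext l
    rw [Pi.add_apply]
    by_cases h1 : l = i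
    · have := hw' i₀
      rw [Equiv.swap_apply_right] at this
      rw [h1, this, Pi.single_eq_of_ne hne]
      omega
    by_cases h2 : l = i₀
    · have := hw' i
      rw [Equiv.swap_apply_left] at this
      have h3 := hfl i₀ hne.symm
      rw [h2, this, Pi.single_eq_same]
      omega
    · have := hw' l
      rw [Equiv.swap_apply_of_ne_of_ne h1 h2] at this
      rw [this, hfl l h1, Pi.single_eq_of_ne h2, add_zero]
  have ht1 : (f i).testBit 0 = false := by
    have := testBit_wordExp w i ⟨0, hk⟩
    rw [← hfi, ← hi₀, decide_eq_true hne.symm, Nat.testBit_zero, decide_eq_true_eq] at this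
    rw [Nat.testBit_zero, decide_eq_false_iff_not]
    omega
  have ht2 : (f i₀).testBit 0 = false := by
    rw [hfl i₀ hne.symm]
    exact (testBit_wordExp w i₀ ⟨0, hk⟩).trans (by simp [hi₀])
  rw [Q₀_mon, map_sum, Finset.sum_eq_add i i₀ hne]
  · dsimp only
    rw [Finset.erase_insert hi, hf, hf', ← letters_replaceFirst hk w hi, wordFunctional_wordExp,
      wordFunctional_wordExp]
  · intro j _ hj
    -- Two gaps remain in the place `2^0`, so the first letter of `v` would be both `i` and `i₀`.
    refine wordFunctional_eq_zero fun v _ hv => ?_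
    have h1 := testBit_wordExp v i ⟨0, hk⟩
    have h2 := testBit_wordExp v i₀ ⟨0, hk⟩
    rw [hv] at h1 h2
    dsimp only at h1 h2
    rw [Pi.add_apply, Pi.single_eq_of_ne hj.1.symm, add_zero] at h1
    rw [Pi.add_apply, Pi.single_eq_of_ne hj.2.symm, add_zero] at h2
    change (f i).testBit 0 = _ at h1
    change (f i₀).testBit 0 = _ at h2
    rw [ht1] at h1
    rw [ht2] at h2
    have h3 : v ⟨0, hk⟩ = i := by simpa using h1.symm
    have h4 : v ⟨0, hk⟩ = i₀ := by simpa using h2.symm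
    exact hne (h3.symm.trans h4)
  · intro h; exact absurd (Finset.mem_insert_self _ _) h
  · intro h; exact absurd (Finset.mem_insert_of_mem hi₀w) h

variable (n k) in
/-- The sum of all the coefficients of the monomials `x_S y^e`, where `e` is the exponent of a
word without repetitions and with set of letters `S`. -/
def parity : N n →ₗ[ZMod 2] ZMod 2 := ∑ S : Finset (Fin n), wordFunctional k S

lemma parity_apply (u : N n) : parity n k u = ∑ S : Finset (Fin n), wordFunctional k S u := by
  rw [parity, LinearMap.sum_apply]

lemma parity_P {a : ℕ} (ha : 1 ≤ a) (u : N n) : parity n k (P (ZMod 2) 0 n a u) = 0 := by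
  rw [parity_apply]
  exact Finset.sum_eq_zero fun S _ => wordFunctional_P S ha u

/-- The two word monomials in the Bockstein may have different sets of letters; after summing over
all `S` they contribute `1 + 1 = 0`. -/
lemma parity_Q₀_mon (hk : 0 < k) (z : Mono n) :
    parity n k (Q₀ (ZMod 2) 0 n (mon (ZMod 2) 0 z)) = 0 := by
  rw [parity_apply]
  by_cases h : ∃ i ∈ z.1, ∃ w : Fin k ↪ Fin n, letters w = z.1.erase i ∧
      wordExp w = z.2 + Pi.single i 1
  · obtain ⟨i, hi, w, hw, he⟩ := h
    have hiw : i ∉ letters w := by rw [hw]; exact Finset.notMem_erase _ _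
    have hz : z.1 = insert i (letters w) := by rw [hw, Finset.insert_erase hi]
    rw [Finset.sum_congr rfl fun S _ => wordFunctional_Q₀ hk S z.1 z.2 w hiw hz he.symm,
      Finset.sum_add_distrib]
    simp only [Finset.sum_ite_eq, Finset.mem_univ, if_true]
    exact CharTwo.add_self_eq_zero _
  · push Not at h
    refine Finset.sum_eq_zero fun S _ => ?_
    rw [Q₀_mon, map_sum]
    exact Finset.sum_eq_zero fun i hi => wordFunctional_eq_zero fun w hw => h i hi w hw

lemma parity_Q₀ (hk : 0 < k) (u : N n) : parity n k (Q₀ (ZMod 2) 0 n u) = 0 := by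
  have : parity n k ∘ₗ Q₀ (ZMod 2) 0 n = 0 := linearMap_ext_mon fun z => parity_Q₀_mon hk z
  exact LinearMap.congr_fun this u

/-! ### Words with the same letters agree modulo `Gₙ` -/

/-- The two numbers differ only by the digit `2^(j+1)` against `2^j`, and `2^(j+1) - 2^j = 2^j`. -/
lemma ofBits_carry {g g' : Fin k → Bool} {j : ℕ} (hj : j + 1 < k)
    (h1 : g ⟨j, by omega⟩ = false) (h2 : g ⟨j + 1, hj⟩ = true)
    (h3 : g' ⟨j, by omega⟩ = true) (h4 : g' ⟨j + 1, hj⟩ = false)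
    (h : ∀ l : Fin k, (l : ℕ) ≠ j → (l : ℕ) ≠ j + 1 → g l = g' l) :
    Nat.ofBits g = Nat.ofBits g' + 2 ^ j := by
  have key : ∑ l : Fin k, ((if g l = true then 2 ^ (l : ℕ) else 0) +
        (if l = ⟨j, by omega⟩ then 2 ^ j else 0)) =
      ∑ l : Fin k, ((if g' l = true then 2 ^ (l : ℕ) else 0) +
        (if l = ⟨j + 1, hj⟩ then 2 ^ (j + 1) else 0)) := by
    refine Finset.sum_congr rfl fun l _ => ?_
    by_cases hl : (l : ℕ) = j
    · obtain rfl : l = ⟨j, Nat.lt_of_succ_lt hj⟩ := Fin.ext hl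
      simp [h1, h3]
    by_cases hl' : (l : ℕ) = j + 1
    · obtain rfl : l = ⟨j + 1, hj⟩ := Fin.ext hl'
      simp [h2, h4]
    · have e1 : l ≠ ⟨j, by omega⟩ := fun h => hl (congrArg Fin.val h)
      have e2 : l ≠ ⟨j + 1, hj⟩ := fun h => hl' (congrArg Fin.val h)
      simp [h l hl hl', e1, e2]
  rw [Finset.sum_add_distrib, Finset.sum_add_distrib, Finset.sum_ite_eq', Finset.sum_ite_eq',
    if_pos (Finset.mem_univ _), if_pos (Finset.mem_univ _), ← ofBits_eq_sum, ← ofBits_eq_sum,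
    pow_succ] at key
  omega

/-- The exponents obtained from those of the word `w` by moving, for the index `w j`, the digit in
the place `2^(j+1)` to the place `2^j`. -/
def exchange (w : Fin k → Fin n) {j : ℕ} (hj : j + 1 < k) (i : Fin n) : ℕ :=
  Nat.ofBits fun l : Fin k => if (l : ℕ) = j then true else
    if (l : ℕ) = j + 1 then decide (w ⟨j, by omega⟩ ≠ i ∧ w ⟨j + 1, hj⟩ ≠ i) else decide (w l ≠ i)

lemma wordExp_eq_exchange (w : Fin k → Fin n) {j : ℕ} (hj : j + 1 < k)
    (hne : w ⟨j, by omega⟩ ≠ w ⟨j + 1, hj⟩) :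
    wordExp w = exchange w hj + Pi.single (w ⟨j, by omega⟩) (2 ^ j) := by
  funext i
  rw [Pi.add_apply]
  by_cases hi : i = w ⟨j, by omega⟩
  · subst hi
    rw [Pi.single_eq_same]
    refine ofBits_carry hj (by simp) (by simpa using hne.symm) (by simp) (by simp) fun l h1 h2 => ?_
    simp [h1, h2]
  · rw [Pi.single_eq_of_ne hi, add_zero, wordExp, exchange]
    congr 1
    funext l
    by_cases h1 : (l : ℕ) = j
    · obtain rfl : l = ⟨j, Nat.lt_of_succ_lt hj⟩ := Fin.ext h1
      simpa using Ne.symm hi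
    by_cases h2 : (l : ℕ) = j + 1
    · obtain rfl : l = ⟨j + 1, hj⟩ := Fin.ext h2
      simp [Ne.symm hi]
    · simp [h1, h2]

/-- In `exchange w hj` the place `2^j` is full and the place `2^(j+1)` is missing at both letters,
which is symmetric in them. So one monomial serves as the source of both words. -/
lemma exchange_swap (w : Fin k → Fin n) {j : ℕ} (hj : j + 1 < k) :
    exchange (w ∘ Equiv.swap ⟨j, by omega⟩ ⟨j + 1, hj⟩) hj = exchange w hj := by
  funext i
  rw [exchange, exchange]
  congr 1
  funext l
  by_cases h1 : (l : ℕ) = j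
  · simp [h1]
  by_cases h2 : (l : ℕ) = j + 1
  · simp [h2, and_comm]
  · have e1 : l ≠ ⟨j, by omega⟩ := fun h => h1 (congrArg Fin.val h)
    have e2 : l ≠ ⟨j + 1, hj⟩ := fun h => h2 (congrArg Fin.val h)
    simp [h1, h2, Equiv.swap_apply_of_ne_of_ne e1 e2]

lemma testBit_add_of_dvd {a b l : ℕ} (h : 2 ^ l ∣ b) :
    (a + b).testBit l = (a.testBit l ^^ b.testBit l) := by
  obtain ⟨q, rfl⟩ := h
  simp only [Nat.testBit_eq_decide_div_mod_eq]
  rw [Nat.add_mul_div_left _ _ (by positivity), Nat.mul_div_cancel_left _ (by positivity)]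
  rcases Nat.mod_two_eq_zero_or_one (a / 2 ^ l) with h1 | h1 <;>
    rcases Nat.mod_two_eq_zero_or_one q with h2 | h2 <;> simp [Nat.add_mod, h1, h2]

lemma pow_succ_dvd_of_testBit {b l : ℕ} (h : 2 ^ l ∣ b) (hb : b.testBit l = false) :
    2 ^ (l + 1) ∣ b := by
  obtain ⟨q, rfl⟩ := h
  rw [Nat.testBit_eq_decide_div_mod_eq, Nat.mul_div_cancel_left _ (by positivity),
    decide_eq_false_iff_not] at hb
  rw [pow_succ]
  exact mul_dvd_mul_left _ (by omega)

/-- No digit of `h` lies below the place `2^j`, so its total `2^j` is concentrated at one index. In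
the place `2^(j+1)` two gaps are left unless that index is one of the two letters. -/
lemma eq_single_of_exchange_add (w v : Fin k → Fin n) {j : ℕ} (hj : j + 1 < k)
    (hne : w ⟨j, by omega⟩ ≠ w ⟨j + 1, hj⟩) (h : Fin n → ℕ) (hsum : ∑ i, h i = 2 ^ j)
    (hodd : ∀ i, Odd ((exchange w hj i).choose (h i))) (hv : exchange w hj + h = wordExp v) :
    h = Pi.single (w ⟨j, by omega⟩) (2 ^ j) ∨ h = Pi.single (w ⟨j + 1, hj⟩) (2 ^ j) := by
  have hdvd : ∀ l ≤ j, ∀ i, 2 ^ l ∣ h i := by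
    intro l
    induction l with
    | zero => intro _ i; simp
    | succ l ih =>
      intro hl i
      refine pow_succ_dvd_of_testBit (ih (by omega) i) ?_
      have hf : ∀ i, (exchange w hj i).testBit l = decide (w ⟨l, by omega⟩ ≠ i) := by
        intro i
        rw [exchange, Nat.testBit_ofBits_lt _ _ (by omega)]
        have e1 : l ≠ j := by omega
        have e2 : l ≠ j + 1 := by omega
        simp [e1, e2]
      have hb : ∀ i, decide (v ⟨l, by omega⟩ ≠ i) =
          (decide (w ⟨l, by omega⟩ ≠ i) ^^ (h i).testBit l) := by
        intro i
        rw [← hf, ← testBit_add_of_dvd (ih (by omega) i), ← testBit_wordExp v i ⟨l, by omega⟩, ← hv]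
        rfl
      -- A digit of `h i` here must sit on a digit of `exchange w hj i`, so it opens a gap at `i`.
      -- The old gap at the letter `w l` stays open, and `v` would need two letters in this place.
      by_contra hbit
      rw [Bool.not_eq_false] at hbit
      have h1 := testBit_of_odd_choose (hodd i) l hbit
      rw [hf] at h1
      have h2 := hb i
      rw [hbit, h1] at h2
      have h3 : (h (w ⟨l, by omega⟩)).testBit l = false := by
        by_contra hbit'
        rw [Bool.not_eq_false] at hbit'
        have := testBit_of_odd_choose (hodd _) l hbit'
        rw [hf] at this
        simp at this
      have h4 := hb (w ⟨l, by omega⟩)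
      rw [h3] at h4
      simp only [ne_eq, not_true_eq_false, decide_false, Bool.xor_false, decide_eq_false_iff_not,
        not_not, decide_eq_true_eq, Bool.xor_true, Bool.not_true] at h1 h2 h4
      exact h1 (h4.symm.trans h2)
  obtain ⟨i, hi⟩ : ∃ i, h i ≠ 0 := by
    by_contra! hc
    rw [Finset.sum_eq_zero fun i _ => hc i] at hsum
    have : 0 < 2 ^ j := by positivity
    omega
  have hle := Nat.le_of_dvd (Nat.pos_of_ne_zero hi) (hdvd j le_rfl i)
  have hs : h = Pi.single i (2 ^ j) := by
    have h1 := Finset.add_sum_erase Finset.univ h (Finset.mem_univ i)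
    rw [hsum] at h1
    have h2 : ∑ l ∈ Finset.univ.erase i, h l = 0 := by omega
    funext l
    by_cases hl : l = i
    · subst hl; rw [Pi.single_eq_same]; omega
    · rw [Pi.single_eq_of_ne hl]
      exact Finset.sum_eq_zero_iff.1 h2 l (Finset.mem_erase.2 ⟨hl, Finset.mem_univ _⟩)
  by_cases h1 : i = w ⟨j, by omega⟩
  · exact Or.inl (h1 ▸ hs)
  by_cases h2 : i = w ⟨j + 1, hj⟩
  · exact Or.inr (h2 ▸ hs)
  -- The indices `w j` and `w (j+1)` are untouched and both still miss the place `2^(j+1)`.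
  exfalso
  have hbit : ∀ l, l ≠ i → (exchange w hj l).testBit (j + 1) = false → v ⟨j + 1, hj⟩ = l := by
    intro l hl hb
    have := testBit_wordExp v l ⟨j + 1, hj⟩
    rw [← hv, Pi.add_apply, hs, Pi.single_eq_of_ne hl, add_zero] at this
    have h3 := this.symm.trans hb
    simpa using h3
  refine hne ((hbit _ (Ne.symm h1) ?_).symm.trans (hbit _ (Ne.symm h2) ?_)) <;>
  · rw [exchange, Nat.testBit_ofBits_lt _ _ hj]
    simp

lemma mon_mem_G_of_lower {e : Fin n → ℕ}
    (h : ∃ j < k, (∀ i < j, bitCount e i = n - 1) ∧ bitCount e j < n - 1) :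
    mon (ZMod 2) 0 ((∅, e) : Mono n) ∈ G n k := by
  obtain ⟨j, hj, h1, h2⟩ := h
  refine Submodule.subset_span (Or.inr ⟨e, ⟨⟨j, hj⟩, fun i hi => ?_, ?_⟩, rfl⟩)
  · change ω ((∅, e) : Mono n) ((i : ℕ) + 1) = n - 1
    rw [omega_succ]; exact h1 i hi
  · change ω ((∅, e) : Mono n) (j + 1) < n - 1
    rw [omega_succ]; exact h2

lemma mon_mem_Y (e : Fin n → ℕ) : mon (ZMod 2) 0 ((∅, e) : Mono n) ∈ Y n :=
  Submodule.subset_span ⟨e, rfl⟩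

/-- Apply `P^(2^j)` to the monomial with exponents `exchange w hj`. The two words occur with odd
coefficient, since the digit `2^j` is full. Every other term has an even coefficient or is
lexicographically lower, by `lower_or_eq_wordExp` and `eq_single_of_exchange_add`. -/
lemma mon_add_mon_swap_mem_G (w : Fin k → Fin n) {j : ℕ} (hj : j + 1 < k)
    (hne : w ⟨j, by omega⟩ ≠ w ⟨j + 1, hj⟩) :
    mon (ZMod 2) 0 ((∅, wordExp w) : Mono n) +
      mon (ZMod 2) 0 (∅, wordExp (w ∘ Equiv.swap ⟨j, by omega⟩ ⟨j + 1, hj⟩)) ∈ G n k := by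
  have hn : 1 ≤ n := by have := (w ⟨j, by omega⟩).2; omega
  have hw := wordExp_eq_exchange w hj hne
  have hw' := wordExp_eq_exchange
    (w ∘ Equiv.swap ⟨j, Nat.lt_of_succ_lt hj⟩ ⟨j + 1, hj⟩) hj (by simpa using hne.symm)
  rw [exchange_swap, Function.comp_apply, Equiv.swap_apply_left] at hw'
  have hbit : ∀ i, (exchange w hj i).testBit j = true := by
    intro i
    rw [exchange, Nat.testBit_ofBits_lt _ _ (by omega)]
    simp
  have hP : P (ZMod 2) 0 n (2 ^ j) (mon (ZMod 2) 0 ((∅, exchange w hj) : Mono n)) ∈ G n k :=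
    Submodule.subset_span (Or.inl ⟨_, NonUnitalAlgebra.subset_adjoin _
      ⟨2 ^ j, Nat.one_le_two_pow, rfl⟩, _, mon_mem_Y _, rfl⟩)
  have hmem : ∀ a, Pi.single a (2 ^ j) ∈
      Fintype.piFinset fun i => Finset.range (exchange w hj i + 1) := by
    intro a
    refine Fintype.mem_piFinset.2 fun i => Finset.mem_range.2 ?_
    by_cases hi : i = a
    · subst hi
      rw [Pi.single_eq_same]
      exact Nat.lt_succ_of_le (Nat.ge_two_pow_of_testBit (hbit i))
    · rw [Pi.single_eq_of_ne hi]; omega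
  have hterm : ∀ a, (if ∑ i, (Pi.single a (2 ^ j) : Fin n → ℕ) i = 2 ^ j then
      ((∏ i, (exchange w hj i).choose ((Pi.single a (2 ^ j) : Fin n → ℕ) i) : ℕ) : ZMod 2) •
        mon (ZMod 2) 0 ((∅, exchange w hj + Pi.single a (2 ^ j)) : Mono n) else 0) =
      mon (ZMod 2) 0 ((∅, exchange w hj + Pi.single a (2 ^ j)) : Mono n) := by
    intro a
    rw [if_pos (by simp), Finset.prod_eq_single a
      (fun i _ hi => by rw [Pi.single_eq_of_ne hi, Nat.choose_zero_right]) (by simp),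
      Pi.single_eq_same, (ZMod.natCast_eq_one_iff_odd).2 (odd_choose_two_pow (hbit a)), one_smul]
  -- The terms in which the whole increment `2^j` goes to one of the two letters are split off from
  -- the sum.
  rw [P_mon, ← Finset.add_sum_erase _ _ (hmem (w ⟨j, by omega⟩)),
    ← Finset.add_sum_erase _ _ (Finset.mem_erase.2 ⟨fun h => hne.symm ?_,
      hmem (w ⟨j + 1, hj⟩)⟩), hterm, hterm, ← hw, ← hw', ← add_assoc] at hP
  · refine (Submodule.add_mem_iff_left _ (Submodule.sum_mem _ fun h hh => ?_)).1 hP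
    obtain ⟨hb, hh⟩ := Finset.mem_erase.1 hh
    obtain ⟨ha, hh⟩ := Finset.mem_erase.1 hh
    split_ifs with hsum
    · by_cases hodd : ∀ i, Odd ((exchange w hj i).choose (h i))
      · refine Submodule.smul_mem _ _ ?_
        have hd : ∑ i, (exchange w hj + h) i = dOne n k := by
          rw [← sum_wordExp w, hw]
          simp only [Pi.add_apply, Finset.sum_add_distrib, hsum]
          simp
        rcases lower_or_eq_wordExp hn (exchange w hj + h) hd with hl | ⟨v, hv⟩
        · exact mon_mem_G_of_lower hl
        · exact ((eq_single_of_exchange_add w v hj hne h hsum hodd hv).elim ha hb).elim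
      · push Not at hodd
        obtain ⟨i, hi⟩ := hodd
        rw [Nat.cast_prod, Finset.prod_eq_zero (Finset.mem_univ i), zero_smul]
        · exact zero_mem _
        · exact (ZMod.natCast_eq_zero_iff_even).2 (Nat.not_odd_iff_even.1 hi)
    · exact zero_mem _
  · by_contra hc
    have := congrFun h (w ⟨j + 1, hj⟩)
    rw [Pi.single_eq_same, Pi.single_eq_of_ne hc] at this
    have : 0 < 2 ^ j := by positivity
    omega

lemma prod_x_mul_mon (S : Finset (Fin n)) (e : Fin n → ℕ) :
    (∏ i ∈ S, x (ZMod 2) 0 n i) * mon (ZMod 2) 0 ((∅, e) : Mono n) = mon (ZMod 2) 0 (S, e) := by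
  simp [mon]

lemma mon_sub_mon_swap_mem_topG {S : Finset (Fin n)} (hS : S.card = k) (w : Fin k → Fin n) {j : ℕ}
    (hj : j + 1 < k) (hne : w ⟨j, by omega⟩ ≠ w ⟨j + 1, hj⟩) :
    mon (ZMod 2) 0 (S, wordExp w) -
      mon (ZMod 2) 0 (S, wordExp (w ∘ Equiv.swap ⟨j, by omega⟩ ⟨j + 1, hj⟩)) ∈ topG n k := by
  rw [ZModModule.sub_eq_add, ← prod_x_mul_mon S (wordExp w), ← prod_x_mul_mon S (wordExp (w ∘ _)),
    ← mul_add]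
  exact Submodule.subset_span ⟨S, hS, _, ⟨mon_add_mon_swap_mem_G w hj hne,
    add_mem (Submodule.subset_span ⟨_, sum_wordExp _, rfl⟩)
      (Submodule.subset_span ⟨_, sum_wordExp _, rfl⟩)⟩, rfl⟩

/-- Adjacent transpositions generate the symmetric group; the differences telescope along a product,
with the word changing at each factor. -/
lemma mon_sub_mon_perm_mem_topG {S : Finset (Fin n)} (hS : S.card = k) (p : Equiv.Perm (Fin k))
    (w : Fin k → Fin n) (hw : Function.Injective w) :
    mon (ZMod 2) 0 (S, wordExp w) - mon (ZMod 2) 0 (S, wordExp (w ∘ p)) ∈ topG n k := by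
  obtain _ | k := k
  · rw [Subsingleton.elim (w ∘ p) w, sub_self]; exact zero_mem _
  have hp : p ∈ Submonoid.closure
      (Set.range fun i : Fin k => Equiv.swap i.castSucc i.succ) := by
    rw [Equiv.Perm.mclosure_swap_castSucc_succ]; trivial
  induction hp using Submonoid.closure_induction generalizing w with
  | mem p hp =>
    obtain ⟨i, rfl⟩ := hp
    exact mon_sub_mon_swap_mem_topG hS w (j := i) (by omega)
      (fun h => by simpa using congrArg Fin.val (hw h))
  | one => rw [Equiv.Perm.coe_one, Function.comp_id, sub_self]; exact zero_mem _
  | mul p q _ _ hp hq =>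
    have := add_mem (hp w hw) (hq (w ∘ p) (hw.comp p.injective))
    rwa [sub_add_sub_cancel] at this

/-! ### The functionals on the top layer -/

lemma wordFunctional_of_card_ne {S : Finset (Fin n)} (hS : S.card ≠ k) :
    wordFunctional k S = 0 := by
  rw [wordFunctional]
  refine Finset.sum_eq_zero fun w hw => ?_
  exact absurd ((Finset.mem_filter.1 hw).2 ▸ card_letters w) hS

lemma wordFunctional_exteriorPart (S : Finset (Fin n)) (u : N n) :
    wordFunctional k S (exteriorPart n k u) = wordFunctional k S u := by
  have : wordFunctional k S ∘ₗ exteriorPart n k = wordFunctional k S := by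
    refine linearMap_ext_mon fun z => ?_
    rw [LinearMap.comp_apply, exteriorPart_mon]
    split_ifs with h
    · rfl
    · rw [map_zero, wordFunctional_eq_zero fun w hw _ => h (hw ▸ card_letters w)]
  exact LinearMap.congr_fun this u

/-- Exterior factors pass through the reduced powers, which the functional kills; and a word has all
its digit counts equal to `n - 1`, so none of the lower monomials is a word. -/
lemma wordFunctional_prod_x_mul_G (hn : 1 ≤ n) (S T : Finset (Fin n)) {g : N n} (hg : g ∈ G n k) :
    wordFunctional k S ((∏ i ∈ T, x (ZMod 2) 0 n i) * g) = 0 := by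
  refine Submodule.span_induction
    (p := fun g _ => wordFunctional k S ((∏ i ∈ T, x (ZMod 2) 0 n i) * g) = 0)
    ?_ (by simp) (fun a b _ _ ha hb => by rw [mul_add, map_add, ha, hb, add_zero])
    (fun c a _ ha => by rw [mul_smul_comm, map_smul, ha, smul_zero]) hg
  rintro _ (⟨p, hp, f, -, rfl⟩ | ⟨e, ⟨j, -, hj⟩, rfl⟩)
  · induction hp using NonUnitalAlgebra.adjoin_induction generalizing f with
    | mem p hp =>
      obtain ⟨a, ha, rfl⟩ := hp
      rw [← P_prod_x_mul, wordFunctional_P S ha]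
    | add p q _ _ hp hq => rw [LinearMap.add_apply, mul_add, map_add, hp, hq, add_zero]
    | zero => simp
    -- Only the outermost factor matters, as the hypothesis on `p` holds for every argument.
    | mul p q _ _ hp hq => exact hp (q f)
    | smul c p _ hp => rw [LinearMap.smul_apply, mul_smul_comm, map_smul, hp, smul_zero]
  · rw [prod_x_mul_mon]
    refine wordFunctional_eq_zero fun w _ hw => ?_
    change ω ((∅, e) : Mono n) ((j : ℕ) + 1) < n - 1 at hj
    rw [omega_succ, ← (show wordExp w = e from hw), bitCount_wordExp hn] at hj
    exact lt_irrefl _ hj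

/-- The functional induced by `wordFunctional k S` on `Λₙᵏ ⊗ (Yₙ/Gₙ)^{2d₁}`. -/
def topFunctional (hn : 1 ≤ n) (S : Finset (Fin n)) : TopQuot n k →ₗ[ZMod 2] ZMod 2 :=
  Submodule.liftQ _ (wordFunctional k S ∘ₗ (topPart n k).subtype) (by
    intro u hu
    have hu' : (u : N n) ∈ topG n k := hu
    rw [LinearMap.mem_ker, LinearMap.comp_apply, Submodule.subtype_apply]
    refine Submodule.span_induction (p := fun u _ => wordFunctional k S u = 0)
      ?_ (map_zero _) (fun a b _ _ ha hb => by rw [map_add, ha, hb, add_zero])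
      (fun c a _ ha => by rw [map_smul, ha, smul_zero]) hu'
    rintro _ ⟨T, -, g, hg, rfl⟩
    exact wordFunctional_prod_x_mul_G hn S T hg.1)

lemma topFunctional_π (hn : 1 ≤ n) (S : Finset (Fin n)) (u : topPart n k) :
    topFunctional hn S (π n k u) = wordFunctional k S u := rfl

lemma topFunctional_πMon (hn : 1 ≤ n) (S : Finset (Fin n)) (z : TopMono n k) :
    topFunctional hn S (πMon n k z) = wordFunctional k S (mon (ZMod 2) 0 z.1) := rfl

/-- In a word monomial without repetitions an index loses a digit only if it is a letter, and then
it has the exterior factor in compensation; so every `α_i` is at least `k`. -/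
lemma wordFunctional_of_alpha_lt (S : Finset (Fin n)) {z : Mono n} {i : Fin n} (hi : α z i < k) :
    wordFunctional k S (mon (ZMod 2) 0 z) = 0 := by
  obtain ⟨T, e⟩ := z
  refine wordFunctional_eq_zero fun w hw he => ?_
  dsimp only at hw he
  subst hw he
  have h := alpha_wordExp (letters w) w i
  have hc : (Finset.univ.filter fun j => w j = i).card ≤ if i ∈ letters w then 1 else 0 := by
    split_ifs with hl
    · refine Finset.card_le_one.2 fun a ha b hb => w.injective ?_
      rw [(Finset.mem_filter.1 ha).2, (Finset.mem_filter.1 hb).2]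
    · rw [Nat.le_zero, Finset.card_eq_zero, Finset.filter_eq_empty_iff]
      exact fun j _ hj => hl (mem_letters.2 ⟨j, hj⟩)
  omega

/-! ### The block of the `σ(z_k)` -/

/-- The word of the `y`-part of `σ(z_k)`. -/
def blockWord (σ : Fin k ↪o Fin n) : Fin k ↪ Fin n := Fin.revPerm.toEmbedding.trans σ.toEmbedding

lemma letters_blockWord (σ : Fin k ↪o Fin n) : letters (blockWord σ) = letters σ.toEmbedding := by
  rw [blockWord, letters, ← Finset.map_map, Finset.map_univ_equiv, letters]

/-- The exponent of `y_{σ(j)}` misses the digit `2^(k-j)`, so the word is `σ` read backwards. -/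
lemma zMono_eq (σ : Fin k ↪o Fin n) : zMono σ = (letters (blockWord σ), wordExp (blockWord σ)) := by
  rw [letters_blockWord]
  refine Prod.ext rfl (funext fun i => ?_)
  by_cases h : ∃ j, σ j = i
  · obtain ⟨j, rfl⟩ := h
    have h2 : (zMono σ).2 (σ j) = 2 ^ k - 2 ^ (k - ((j : ℕ) + 1)) - 1 :=
      σ.injective.extend_apply
        (fun j : Fin k => 2 ^ k - 2 ^ (k - ((j : ℕ) + 1)) - 1) (fun _ => 2 ^ k - 1) j
    have h3 := wordExp_apply (blockWord σ).injective (Fin.rev j)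
    have h4 : blockWord σ (Fin.rev j) = σ j := by simp [blockWord]
    rw [h4, Fin.val_rev] at h3
    have h5 : 0 < 2 ^ (k - ((j : ℕ) + 1)) := by positivity
    rw [h2]
    dsimp only
    generalize 2 ^ (k - ((j : ℕ) + 1)) = p at h3 h5 ⊢
    generalize 2 ^ k = q at h3 ⊢
    omega
  · have h2 : (zMono σ).2 i = 2 ^ k - 1 := Function.extend_apply'
      (fun j : Fin k => 2 ^ k - 2 ^ (k - ((j : ℕ) + 1)) - 1) (fun _ => 2 ^ k - 1) i h
    rw [h2]
    exact (wordExp_of_notMem fun j hj => h ⟨_, hj⟩).symm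

lemma letters_orderEmbedding_injective :
    Function.Injective fun σ : Fin k ↪o Fin n => letters σ.toEmbedding := by
  intro σ σ' h
  refine OrderEmbedding.range_inj.1 (Set.ext fun i => ?_)
  have : i ∈ letters σ.toEmbedding ↔ i ∈ letters σ'.toEmbedding := by
    rw [show letters σ.toEmbedding = letters σ'.toEmbedding from h]
  rw [mem_letters, mem_letters] at this
  exact this

lemma exists_letters_eq {S : Finset (Fin n)} (hS : S.card = k) :
    ∃ σ : Fin k ↪o Fin n, letters σ.toEmbedding = S :=
  ⟨S.orderEmbOfFin hS, Finset.map_orderEmbOfFin_univ S hS⟩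

lemma wordFunctional_zMono (S : Finset (Fin n)) (σ : Fin k ↪o Fin n) :
    wordFunctional k S (mon (ZMod 2) 0 (zMono σ)) = if letters σ.toEmbedding = S then 1 else 0 := by
  rw [zMono_eq, wordFunctional_wordExp, letters_blockWord]

lemma parity_zMono (σ : Fin k ↪o Fin n) : parity n k (mon (ZMod 2) 0 (zMono σ)) = 1 := by
  rw [parity_apply]
  simp only [wordFunctional_zMono, Finset.sum_ite_eq, Finset.mem_univ, if_true]

/-- The functionals for the sets of letters form a dual family. -/
lemma linearIndependent_πMon_mOne (hn : 1 ≤ n) :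
    LinearIndependent (ZMod 2) (fun σ : Fin k ↪o Fin n => πMon n k (mOne σ)) := by
  refine LinearIndependent.of_pairwise_dual_eq_zero_one _
    (fun σ => topFunctional hn (letters σ.toEmbedding)) (fun σ σ' h => ?_) fun σ => ?_
  · exact (wordFunctional_zMono _ σ').trans
      (if_neg fun h' => h (letters_orderEmbedding_injective h').symm)
  · exact (wordFunctional_zMono _ σ).trans (if_pos rfl)

lemma πMon_eq_zero_of_mem {z : TopMono n k} (h : mon (ZMod 2) 0 z.1 ∈ topG n k) :
    πMon n k z = 0 := (Submodule.Quotient.mk_eq_zero _).2 h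

lemma πMon_eq_of_sub_mem {z z' : TopMono n k}
    (h : mon (ZMod 2) 0 z.1 - mon (ZMod 2) 0 z'.1 ∈ topG n k) :
    πMon n k z = πMon n k z' := (Submodule.Quotient.eq _).2 h

/-- If all `α_i ≥ k` and the monomial is not lower, it comes from an injective word with letters in
`S`. As `S` has `k` elements, this word is a rearrangement of the `blockWord` of the enumeration `σ`
of `S`. -/
lemma alpha_lt_or_eq (hn : 1 ≤ n) (z : TopMono n k) :
    (∃ i, α z.1 i < k) ∨ πMon n k z = 0 ∨ ∃ σ, πMon n k z = πMon n k (mOne σ) := by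
  by_cases hα : ∃ i, α z.1 i < k
  · exact Or.inl hα
  push Not at hα
  refine Or.inr ?_
  obtain ⟨⟨S, e⟩, hS, he⟩ := z
  dsimp only at hS he hα
  rcases lower_or_eq_wordExp hn e he with h | ⟨w, rfl⟩
  · refine Or.inl (πMon_eq_zero_of_mem ?_)
    dsimp only
    rw [← prod_x_mul_mon]
    exact Submodule.subset_span ⟨S, hS, _, ⟨mon_mem_G_of_lower h,
      Submodule.subset_span ⟨e, he, rfl⟩⟩, rfl⟩
  · have hc : ∀ i, (Finset.univ.filter fun j => w j = i).card ≤ if i ∈ S then 1 else 0 := by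
      intro i
      have := alpha_wordExp S w i
      have := hα i
      omega
    have hinj : Function.Injective w := by
      intro j j' h
      have h1 := (hc (w j')).trans (by split_ifs <;> omega : _ ≤ 1)
      exact Finset.card_le_one.1 h1 j (by simp [h]) j' (by simp)
    obtain ⟨σ, hσ⟩ := exists_letters_eq hS
    have hrange : ∀ j, ∃ l, blockWord σ l = w j := by
      intro j
      rw [← mem_letters, letters_blockWord, hσ]
      by_contra hj
      have := hc (w j)
      rw [if_neg hj, Nat.le_zero, Finset.card_eq_zero, Finset.filter_eq_empty_iff] at this
      exact this (Finset.mem_univ j) rfl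
    choose p hp using hrange
    have hpinj : Function.Injective p := fun a b h => hinj (by rw [← hp, ← hp, h])
    refine Or.inr ⟨σ, (πMon_eq_of_sub_mem ?_).symm⟩
    have h := mon_sub_mon_perm_mem_topG hS
      (Equiv.ofBijective p (Finite.injective_iff_bijective.1 hpinj)) (blockWord σ)
      (blockWord σ).injective
    have hw : blockWord σ ∘ Equiv.ofBijective p (Finite.injective_iff_bijective.1 hpinj) = w :=
      funext hp
    rw [hw] at h
    have hz : (mOne σ).1 = (S, wordExp (blockWord σ)) := by
      rw [← hσ, ← letters_blockWord]; exact zMono_eq σ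
    rw [hz]
    exact h

lemma span_πMon : Submodule.span (ZMod 2) (Set.range (πMon n k)) = ⊤ := by
  rw [eq_top_iff]
  rintro q -
  obtain ⟨⟨u, hu⟩, rfl⟩ := Submodule.mkQ_surjective _ q
  refine Submodule.span_induction
    (p := fun u hu => π n k ⟨u, hu⟩ ∈ Submodule.span (ZMod 2) (Set.range (πMon n k)))
    ?_ ?_ ?_ ?_ hu
  · rintro _ ⟨z, rfl⟩
    exact Submodule.subset_span ⟨z, rfl⟩
  · exact (map_zero (π n k)) ▸ zero_mem _
  · intro a b ha hb h1 h2
    exact (map_add (π n k) ⟨a, ha⟩ ⟨b, hb⟩) ▸ add_mem h1 h2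
  · intro c a ha h1
    exact (map_smul (π n k) c ⟨a, ha⟩) ▸ Submodule.smul_mem _ c h1

/-- The independent family of the `σ(z_k)` is extended to a maximal independent one by monomials
with some `α_i < k`. By `alpha_lt_or_eq` these candidates together span. -/
lemma exists_isComplementaryBlock (hn : 1 ≤ n) :
    ∃ M₀ : Set (TopMono n k), IsComplementaryBlock M₀ := by
  have hinj : Function.Injective (mOne (n := n) (k := k)) := fun σ σ' h =>
    (linearIndependent_πMon_mOne hn).injective (congrArg (πMon n k) h)
  have hli : LinearIndepOn (ZMod 2) (πMon n k) (Set.range mOne) :=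
    (linearIndepOn_range_iff hinj _).2 (linearIndependent_πMon_mOne hn)
  obtain ⟨b, hbt, hsb, hspan, hb⟩ := exists_linearIndepOn_extension hli
    (Set.subset_union_left (t := {z : TopMono n k | ∃ i, α z.1 i < k}))
  refine ⟨b \ Set.range mOne, fun z hz => (hbt hz.1).resolve_left hz.2, ?_, ?_⟩
  · let φ : (b \ Set.range mOne : Set (TopMono n k)) ⊕ (Fin k ↪o Fin n) → b :=
      Sum.elim (fun z => ⟨z.1, z.2.1⟩) (fun σ => ⟨mOne σ, hsb ⟨σ, rfl⟩⟩)
    have hφ : Function.Injective φ := by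
      rintro (z | σ) (z' | σ') h
      · have hz : (φ (Sum.inl z)).1 = (φ (Sum.inl z')).1 := congrArg Subtype.val h
        exact congrArg _ (Subtype.ext hz)
      · exact absurd ⟨σ', (congrArg Subtype.val h).symm⟩ z.2.2
      · exact absurd ⟨σ, congrArg Subtype.val h⟩ z'.2.2
      · exact congrArg _ (hinj (congrArg Subtype.val h))
    have hfam : Sum.elim (fun z : (b \ Set.range mOne : Set (TopMono n k)) => πMon n k z.1)
        (fun σ : Fin k ↪o Fin n => πMon n k (mOne σ)) = (fun z : b => πMon n k z) ∘ φ := by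
      funext s
      rcases s with z | σ <;> rfl
    rw [hfam]
    exact LinearIndependent.comp hb φ hφ
  · have hr : Set.range (Sum.elim
        (fun z : (b \ Set.range mOne : Set (TopMono n k)) => πMon n k z.1)
        (fun σ : Fin k ↪o Fin n => πMon n k (mOne σ))) = πMon n k '' b := by
      ext q
      constructor
      · rintro ⟨z | σ, rfl⟩
        · exact ⟨z.1, z.2.1, rfl⟩
        · exact ⟨mOne σ, hsb ⟨σ, rfl⟩, rfl⟩
      · rintro ⟨z, hz, rfl⟩
        by_cases h : z ∈ Set.range mOne
        · obtain ⟨σ, rfl⟩ := h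
          exact ⟨Sum.inr σ, rfl⟩
        · exact ⟨Sum.inl ⟨z, hz, h⟩, rfl⟩
    rw [hr, eq_top_iff, ← span_πMon, Submodule.span_le]
    rintro _ ⟨z, rfl⟩
    rcases alpha_lt_or_eq hn z with h | h | ⟨σ, h⟩
    · exact hspan ⟨z, Or.inr h, rfl⟩
    · rw [h]; exact zero_mem _
    · rw [h]; exact hspan ⟨mOne σ, Or.inl ⟨σ, rfl⟩, rfl⟩

/-! ### The local projection -/

namespace IsComplementaryBlock

variable {M₀ : Set (TopMono n k)}

/-- `ϑ u` differs from the class of the top part of `u` by an element of `U₀`, on which the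
functional vanishes because of the condition on `α`. The result no longer involves `M₀`. -/
lemma topFunctional_ϑ (h : IsComplementaryBlock M₀) (hn : 1 ≤ n) (S : Finset (Fin n))
    (u : degreePart (ZMod 2) 0 n (k + 2 * dOne n k)) :
    topFunctional hn S (h.ϑ u : TopQuot n k) = wordFunctional k S u := by
  have hU : ∀ q ∈ U₀ M₀, topFunctional hn S q = 0 := by
    intro q hq
    refine Submodule.span_induction (p := fun q _ => topFunctional hn S q = 0)
      ?_ (map_zero _) (fun a b _ _ ha hb => by rw [map_add, ha, hb, add_zero])
      (fun c a _ ha => by rw [map_smul, ha, smul_zero]) hq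
    rintro _ ⟨z, rfl⟩
    obtain ⟨i, hi⟩ := h.alpha_lt z.1 z.2
    exact wordFunctional_of_alpha_lt S hi
  have hmem : π n k (pr n k u) - (h.ϑ u : TopQuot n k) ∈ U₀ M₀ := by
    rw [← Submodule.projectionOnto_apply_eq_zero_iff h.isCompl, map_sub,
      Submodule.projectionOnto_apply_left, sub_eq_zero]
    rfl
  have := hU _ hmem
  rw [map_sub, sub_eq_zero, topFunctional_π] at this
  rw [← this]
  exact wordFunctional_exteriorPart S u

/-- The basis `π(σ(z_k))` of `V`. -/
def basis (h : IsComplementaryBlock M₀) : Module.Basis (Fin k ↪o Fin n) (ZMod 2) (V n k) :=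
  Module.Basis.span h.linearIndependent_mOne

lemma basis_apply (h : IsComplementaryBlock M₀) (σ : Fin k ↪o Fin n) :
    (h.basis σ : TopQuot n k) = πMon n k (mOne σ) :=
  congrArg Subtype.val (Module.Basis.span_apply h.linearIndependent_mOne σ)

lemma basis_repr (h : IsComplementaryBlock M₀) (hn : 1 ≤ n) (v : V n k) (σ : Fin k ↪o Fin n) :
    h.basis.repr v σ = topFunctional hn (letters σ.toEmbedding) (v : TopQuot n k) := by
  have : h.basis.coord σ = topFunctional hn (letters σ.toEmbedding) ∘ₗ (V n k).subtype := by
    refine h.basis.ext fun σ' => ?_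
    rw [LinearMap.comp_apply, Submodule.subtype_apply, basis_apply, topFunctional_πMon,
      Module.Basis.coord_apply, Module.Basis.repr_self, Finsupp.single_apply]
    refine Eq.trans ?_ (wordFunctional_zMono _ σ').symm
    simp only [letters_orderEmbedding_injective.eq_iff]
  exact LinearMap.congr_fun this v

lemma basis_repr_ϑ (h : IsComplementaryBlock M₀) (hn : 1 ≤ n)
    (u : degreePart (ZMod 2) 0 n (k + 2 * dOne n k)) (σ : Fin k ↪o Fin n) :
    h.basis.repr (h.ϑ u) σ = wordFunctional k (letters σ.toEmbedding) u := by
  rw [h.basis_repr hn, topFunctional_ϑ]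

lemma ε_apply (h : IsComplementaryBlock M₀) (v : V n k) : h.ε v = ∑ σ, h.basis.repr v σ :=
  congrFun (Module.Basis.coe_sumCoords_of_fintype h.basis) v |>.trans (by simp)

/-- The coordinates of `ϑ u` are the word functionals for the sets `S` with `k` elements; the other
sets contribute nothing to `parity`. -/
lemma ε_ϑ (h : IsComplementaryBlock M₀) (hn : 1 ≤ n)
    (u : degreePart (ZMod 2) 0 n (k + 2 * dOne n k)) : h.ε (h.ϑ u) = parity n k u := by
  rw [ε_apply, parity_apply]
  refine Fintype.sum_of_injective _ letters_orderEmbedding_injective _ _ (fun S hS => ?_)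
    fun σ => h.basis_repr_ϑ hn u σ
  rw [wordFunctional_of_card_ne fun hc => hS (exists_letters_eq hc), LinearMap.zero_apply]

lemma ε_ne_zero (h : IsComplementaryBlock M₀) (hkn : k ≤ n) : h.ε ≠ 0 := by
  intro h0
  have h1 := h.ε_apply (h.basis (Fin.castLEOrderEmb hkn))
  rw [h0, LinearMap.zero_apply, Module.Basis.repr_self] at h1
  simp at h1

end IsComplementaryBlock

/-! ### Hit elements -/

lemma parity_eq_zero_of_mem_hit (hk : 0 < k) {u : N n} (hu : u ∈ hit (ZMod 2) 0 n) :
    parity n k u = 0 := by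
  refine Submodule.span_induction (p := fun u _ => parity n k u = 0)
    ?_ (map_zero _) (fun a b _ _ ha hb => by rw [map_add, ha, hb, add_zero])
    (fun c a _ ha => by rw [map_smul, ha, smul_zero]) hu
  rintro _ ⟨a, ha, u, rfl⟩
  induction ha using NonUnitalAlgebra.adjoin_induction generalizing u with
  | mem a ha =>
    obtain (rfl | rfl) | ⟨a, ha, rfl⟩ := ha
    · simp
    · exact parity_Q₀ hk u
    · exact parity_P ha u
  | add p q _ _ hp hq => rw [LinearMap.add_apply, map_add, hp, hq, add_zero]
  | zero => simp
  | mul p q _ _ hp hq => exact hp (q u)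
  | smul c p _ hp => rw [LinearMap.smul_apply, map_smul, hp, smul_zero]

lemma mon_mem_degreePart (B : Type) [CommRing B] (τ : B) {d : ℕ} {z : Mono n}
    (h : z.1.card + 2 * ∑ i, z.2 i = d) : mon B τ z ∈ degreePart B τ n d :=
  Submodule.subset_span ⟨z, h, rfl⟩

/-- The element is the Bockstein of the word monomial with the factor `yᵢ` traded for `xᵢ`. This is
possible since the exponent at a non-letter is `2^k - 1 ≥ 1`. -/
lemma exists_hit_wordFunctional (hk : 0 < k) (w : Fin k ↪ Fin n) {i : Fin n}
    (hi : i ∉ letters w) :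
    ∃ u : degreePart (ZMod 2) 0 n (k + 2 * dOne n k), (u : N n) ∈ hit (ZMod 2) 0 n ∧
      ∀ S, wordFunctional k S (u : N n) =
        (if letters w = S then 1 else 0) + if letters (replaceFirst hk w i) = S then 1 else 0 := by
  have e1 : wordExp w i = 2 ^ k - 1 := wordExp_of_notMem fun j hj => hi (mem_letters.2 ⟨j, hj⟩)
  have e2 : 2 ≤ 2 ^ k := Nat.le_self_pow hk.ne' 2
  set f : Fin n → ℕ := wordExp w - Pi.single i 1 with hf
  have hfe : f + Pi.single i 1 = wordExp w := by
    refine tsub_add_cancel_of_le fun l => ?_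
    change (Pi.single i 1 : Fin n → ℕ) l ≤ wordExp w l
    by_cases hl : l = i
    · subst hl; rw [Pi.single_eq_same]; omega
    · rw [Pi.single_eq_of_ne hl]; omega
  have hsum : ∑ l, f l + 1 = dOne n k := by
    rw [← sum_wordExp w, ← hfe]
    simp [Finset.sum_add_distrib]
  refine ⟨⟨Q₀ (ZMod 2) 0 n (mon (ZMod 2) 0 (insert i (letters w), f)), ?_⟩, ?_, fun S =>
    wordFunctional_Q₀ hk S _ f w hi rfl hfe⟩
  · rw [Q₀_mon]
    refine Submodule.sum_mem _ fun j hj => mon_mem_degreePart _ _ ?_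
    dsimp only at hj ⊢
    rw [Finset.card_erase_of_mem hj, Finset.card_insert_of_notMem hi, card_letters]
    simp only [Pi.add_apply, Finset.sum_add_distrib, Finset.sum_pi_single', Finset.mem_univ,
      if_true]
    omega
  · exact Submodule.subset_span ⟨_, NonUnitalAlgebra.subset_adjoin _ (Or.inl (Or.inr rfl)), _, rfl⟩

namespace IsComplementaryBlock

variable {M₀ : Set (TopMono n k)}

/-- The image under `ϑ` of the hit elements. -/
abbrev hitImage (h : IsComplementaryBlock M₀) : Submodule (ZMod 2) (V n k) :=
  Submodule.map h.ϑ ((hit (ZMod 2) 0 n).submoduleOf (degreePart (ZMod 2) 0 n (k + 2 * dOne n k)))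

lemma basis_sub_basis_mem_of_exchange (h : IsComplementaryBlock M₀) (hk : 0 < k)
    (σ σ' : Fin k ↪o Fin n) {i i₀ : Fin n} (hi : i ∉ letters σ.toEmbedding)
    (hi₀ : i₀ ∈ letters σ.toEmbedding)
    (hσ : letters σ'.toEmbedding = (insert i (letters σ.toEmbedding)).erase i₀) :
    h.basis σ - h.basis σ' ∈ h.hitImage := by
  obtain ⟨j, rfl⟩ := mem_letters.1 hi₀
  -- The order of the letters is free, so the word is made to start with the letter to be removed.
  set w : Fin k ↪ Fin n := (Equiv.swap ⟨0, hk⟩ j).toEmbedding.trans σ.toEmbedding with hw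
  have hwl : letters w = letters σ.toEmbedding := by
    rw [hw, letters, ← Finset.map_map, Finset.map_univ_equiv, letters]
  have hw0 : w ⟨0, hk⟩ = σ.toEmbedding j := by simp [hw]
  have hiw : i ∉ letters w := by rw [hwl]; exact hi
  have hw' : letters (replaceFirst hk w i) = letters σ'.toEmbedding := by
    rw [letters_replaceFirst hk w hiw, hwl, hw0, hσ]
  obtain ⟨u, hu, hS⟩ := exists_hit_wordFunctional hk w hiw
  refine ⟨u, hu, h.basis.ext_elem fun ρ => ?_⟩
  rw [h.basis_repr_ϑ i.pos, hS, hwl, hw', ZModModule.sub_eq_add, map_add, Finsupp.add_apply,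
    Module.Basis.repr_self, Module.Basis.repr_self, Finsupp.single_apply, Finsupp.single_apply]
  simp only [letters_orderEmbedding_injective.eq_iff]

/-- Any two sets with `k` elements are joined by exchanges of one element, each of which brings the
first set closer to the second. -/
lemma basis_sub_basis_mem (h : IsComplementaryBlock M₀) (hk : 0 < k) (σ σ' : Fin k ↪o Fin n) :
    h.basis σ - h.basis σ' ∈ h.hitImage := by
  induction hm : (letters σ'.toEmbedding \ letters σ.toEmbedding).card generalizing σ with
  | zero =>
    have hsub := Finset.sdiff_eq_empty_iff_subset.1 (Finset.card_eq_zero.1 hm)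
    have heq := Finset.eq_of_subset_of_card_le hsub (by rw [card_letters, card_letters])
    rw [letters_orderEmbedding_injective heq, sub_self]
    exact zero_mem _
  | succ m ih =>
    obtain ⟨i, hi⟩ := Finset.card_pos.1 (by omega :
      0 < (letters σ'.toEmbedding \ letters σ.toEmbedding).card)
    obtain ⟨i₀, hi₀⟩ := Finset.card_pos.1 (by
      rw [Finset.card_sdiff_comm (by rw [card_letters, card_letters])]; omega :
      0 < (letters σ.toEmbedding \ letters σ'.toEmbedding).card)
    rw [Finset.mem_sdiff] at hi hi₀
    obtain ⟨ρ, hρ⟩ := exists_letters_eq (k := k)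
      (S := (insert i (letters σ.toEmbedding)).erase i₀) (by
        rw [Finset.card_erase_of_mem (Finset.mem_insert_of_mem hi₀.1),
          Finset.card_insert_of_notMem hi.2, card_letters]; rfl)
    rw [← sub_add_sub_cancel _ (h.basis ρ)]
    refine add_mem (h.basis_sub_basis_mem_of_exchange hk σ ρ hi.2 hi₀.1 hρ) (ih ρ ?_)
    have : letters σ'.toEmbedding \ letters ρ.toEmbedding =
        (letters σ'.toEmbedding \ letters σ.toEmbedding).erase i := by
      ext l
      rw [hρ]
      simp only [Finset.mem_sdiff, Finset.mem_erase, Finset.mem_insert, not_and, not_or]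
      constructor
      · rintro ⟨h1, h2⟩
        have h3 := h2 (fun h => hi₀.2 (h ▸ h1))
        exact ⟨h3.1, h1, h3.2⟩
      · rintro ⟨h1, h2, h3⟩
        exact ⟨h2, fun _ => ⟨h1, h3⟩⟩
    rw [this, Finset.card_erase_of_mem (Finset.mem_sdiff.2 hi), hm]
    rfl

/-- A vector with coordinate sum zero is a combination of differences with one fixed basis vector.
-/
lemma hitImage_eq_ker (h : IsComplementaryBlock M₀) (hk : 0 < k) (hkn : k ≤ n) :
    h.hitImage = LinearMap.ker h.ε := by
  have hn : 1 ≤ n := by omega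
  refine le_antisymm ?_ fun v hv => ?_
  · rintro _ ⟨u, hu, rfl⟩
    rw [LinearMap.mem_ker, h.ε_ϑ hn]
    exact parity_eq_zero_of_mem_hit hk hu
  · rw [LinearMap.mem_ker, h.ε_apply] at hv
    set σ₀ : Fin k ↪o Fin n := Fin.castLEOrderEmb hkn
    have : v = ∑ σ, h.basis.repr v σ • (h.basis σ - h.basis σ₀) := by
      simp only [smul_sub, Finset.sum_sub_distrib, ← Finset.sum_smul, hv, zero_smul, sub_zero]
      exact (h.basis.sum_repr v).symm
    rw [this]
    exact Submodule.sum_mem _ fun σ _ =>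
      Submodule.smul_mem _ _ (h.basis_sub_basis_mem hk σ σ₀)

end IsComplementaryBlock

/-! ### Reduction modulo `τ` -/

/-- The quotient map `Mₙ → Nₙ = Mₙ/(τ)`. -/
def reduction (n : ℕ) : M n →+* N n :=
  Ideal.Quotient.lift _ (MvPolynomial.eval₂Hom
    ((algebraMap (ZMod 2) (N n)).comp Polynomial.constantCoeff)
    (Sum.elim (x (ZMod 2) 0 n) (y (ZMod 2) 0 n))) (by
      intro p hp
      obtain ⟨c, rfl⟩ := Ideal.mem_span_range_iff_exists_fun.1 hp
      rw [map_sum]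
      refine Finset.sum_eq_zero fun i _ => ?_
      have h := x_sq (ZMod 2) 0 n i
      rw [map_zero, zero_mul, add_zero] at h
      simp [h])

lemma reduction_mk (p : MvPolynomial (Fin n ⊕ Fin n) (Polynomial (ZMod 2))) :
    reduction n (Mot.mk _ _ n p) = MvPolynomial.eval₂Hom
      ((algebraMap (ZMod 2) (N n)).comp Polynomial.constantCoeff)
      (Sum.elim (x (ZMod 2) 0 n) (y (ZMod 2) 0 n)) p := rfl

lemma reduction_x (i : Fin n) :
    reduction n (x (Polynomial (ZMod 2)) Polynomial.X n i) = x (ZMod 2) 0 n i := by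
  rw [x, reduction_mk]; simp

lemma reduction_y (i : Fin n) :
    reduction n (y (Polynomial (ZMod 2)) Polynomial.X n i) = y (ZMod 2) 0 n i := by
  rw [y, reduction_mk]; simp

lemma reduction_algebraMap (b : Polynomial (ZMod 2)) :
    reduction n (algebraMap _ (M n) b) = algebraMap (ZMod 2) (N n) (Polynomial.constantCoeff b) := by
  rw [← AlgHom.commutes (Mot.mk (Polynomial (ZMod 2)) Polynomial.X n), reduction_mk,
    MvPolynomial.algebraMap_eq, MvPolynomial.coe_eval₂Hom, MvPolynomial.eval₂_C]
  rfl

lemma reduction_smul (b : Polynomial (ZMod 2)) (u : M n) :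
    reduction n (b • u) = Polynomial.constantCoeff b • reduction n u := by
  rw [Algebra.smul_def, map_mul, reduction_algebraMap, Algebra.smul_def]

lemma reduction_mon (z : Mono n) :
    reduction n (mon (Polynomial (ZMod 2)) Polynomial.X z) = mon (ZMod 2) 0 z := by
  simp [mon, reduction_x, reduction_y]

/-- Reduction modulo `τ` on the targets of the total operations. -/
def totalReduction (n : ℕ) : TotalTarget (Polynomial (ZMod 2)) Polynomial.X n →+*
    TotalTarget (ZMod 2) 0 n where
  toFun q := ⟨q.re.map (reduction n), q.im.map (reduction n)⟩
  map_one' := QuadraticAlgebra.ext (Polynomial.map_one _) (Polynomial.map_zero _)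
  map_zero' := by ext1 <;> simp
  map_add' p q := by ext1 <;> simp
  map_mul' p q := by
    ext1 <;> simp [QuadraticAlgebra.re_mul, QuadraticAlgebra.im_mul, reduction_algebraMap]

/-- Both sides are ring homomorphisms in `u`, so constants and generators suffice. Hence `Pᵃ` and
`Q₀` commute with reduction. -/
lemma totalReduction_total (u : M n) :
    totalReduction n (total (Polynomial (ZMod 2)) Polynomial.X n u) =
      total (ZMod 2) 0 n (reduction n u) := by
  obtain ⟨p, rfl⟩ := mk_surjective (Polynomial (ZMod 2)) Polynomial.X u
  have : ((totalReduction n).comp (total (Polynomial (ZMod 2)) Polynomial.X n).toRingHom).comp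
      (Mot.mk (Polynomial (ZMod 2)) Polynomial.X n).toRingHom =
      ((total (ZMod 2) 0 n).toRingHom.comp (reduction n)).comp
        (Mot.mk (Polynomial (ZMod 2)) Polynomial.X n).toRingHom := by
    refine MvPolynomial.ringHom_ext (fun b => ?_) fun i => ?_
    · change totalReduction n (total _ _ n (Mot.mk _ _ n (algebraMap _ _ b))) =
        total (ZMod 2) 0 n (reduction n (Mot.mk _ _ n (algebraMap _ _ b)))
      rw [AlgHom.commutes, AlgHom.commutes, reduction_algebraMap, AlgHom.commutes]
      change (⟨Polynomial.map (reduction n) (Polynomial.C (algebraMap _ (M n) b)),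
        Polynomial.map (reduction n) 0⟩ : TotalTarget (ZMod 2) 0 n) =
        ⟨Polynomial.C (algebraMap _ (N n) (Polynomial.constantCoeff b)), 0⟩
      rw [Polynomial.map_C, reduction_algebraMap, Polynomial.map_zero]
    · obtain i | i := i
      · change totalReduction n (total _ _ n (x _ _ n i)) =
          total (ZMod 2) 0 n (reduction n (x _ _ n i))
        rw [reduction_x, total, total, Mot.lift_x, Mot.lift_x]
        simp [totalReduction, reduction_x, reduction_y]
      · change totalReduction n (total _ _ n (y _ _ n i)) =
          total (ZMod 2) 0 n (reduction n (y _ _ n i))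
        rw [reduction_y, total, total, Mot.lift_y, Mot.lift_y]
        simp [totalReduction, reduction_y]
  exact RingHom.congr_fun this p

lemma reduction_P (a : ℕ) (u : M n) :
    reduction n (P (Polynomial (ZMod 2)) Polynomial.X n a u) =
      P (ZMod 2) 0 n a (reduction n u) := by
  have h := congrArg (fun q => q.re.coeff a) (totalReduction_total u)
  exact (Polynomial.coeff_map _ _).symm.trans h

lemma reduction_Q₀ (u : M n) :
    reduction n (Q₀ (Polynomial (ZMod 2)) Polynomial.X n u) = Q₀ (ZMod 2) 0 n (reduction n u) := by
  have h := congrArg (fun q => q.im.coeff 0) (totalReduction_total u)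
  exact (Polynomial.coeff_map _ _).symm.trans h

/-- The generator `τ` reduces to zero, and the other generators commute with reduction, so hit
elements of `Mₙ` are detected in `Nₙ`. -/
lemma parity_reduction_eq_zero_of_mem_hit (hk : 0 < k) {u : M n}
    (hu : u ∈ hit (Polynomial (ZMod 2)) Polynomial.X n) : parity n k (reduction n u) = 0 := by
  refine Submodule.span_induction (p := fun u _ => parity n k (reduction n u) = 0)
    ?_ (by simp) (fun a b _ _ ha hb => by rw [map_add, map_add, ha, hb, add_zero])
    (fun c a _ ha => by rw [reduction_smul, map_smul, ha, smul_zero]) hu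
  rintro _ ⟨a, ha, u, rfl⟩
  induction ha using NonUnitalAlgebra.adjoin_induction generalizing u with
  | mem a ha =>
    obtain (rfl | rfl) | ⟨a, ha, rfl⟩ := ha
    · rw [LinearMap.smul_apply, Module.End.one_apply, reduction_smul]
      simp
    · rw [reduction_Q₀, parity_Q₀ hk]
    · rw [reduction_P, parity_P ha]
  | add p q _ _ hp hq => rw [LinearMap.add_apply, map_add, map_add, hp, hq, add_zero]
  | zero => simp
  | mul p q _ _ hp hq => exact hp (q u)
  | smul c p _ hp => rw [LinearMap.smul_apply, reduction_smul, map_smul, hp, smul_zero]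

lemma parity_sum_zMono {S : Finset (Fin k ↪o Fin n)} (hS : Odd S.card) :
    parity n k (∑ σ ∈ S, mon (ZMod 2) 0 (zMono σ)) = 1 := by
  rw [map_sum, Finset.sum_congr rfl fun σ _ => parity_zMono σ, Finset.sum_const, nsmul_one]
  exact ZMod.natCast_eq_one_iff_odd.2 hS

lemma sum_zMono_mem_degreePart (B : Type) [CommRing B] (τ : B) (S : Finset (Fin k ↪o Fin n)) :
    ∑ σ ∈ S, mon B τ (zMono σ) ∈ degreePart B τ n (k + 2 * dOne n k) :=
  Submodule.sum_mem _ fun σ _ => mon_mem_degreePart B τ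
    (by rw [(zMono_mem σ).1, (zMono_mem σ).2])

end MotivicHit
end

/-! ### The local parity criterion -/

theorem mainTheorem1 (n k : ℕ) (hn : 2 ≤ n) (hk : 1 ≤ k) (hkn : k < n) :
    (∃ M₀ : Set (MotivicHit.TopMono n k), MotivicHit.IsComplementaryBlock M₀) ∧
    (∀ (M₀ : Set (MotivicHit.TopMono n k)) (h : MotivicHit.IsComplementaryBlock M₀),
      h.ε ≠ 0 ∧
      Submodule.map h.ϑ ((MotivicHit.hit (ZMod 2) 0 n).submoduleOf
        (MotivicHit.degreePart (ZMod 2) 0 n (k + 2 * MotivicHit.dOne n k))) = LinearMap.ker h.ε ∧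
      ∀ u : MotivicHit.degreePart (ZMod 2) 0 n (k + 2 * MotivicHit.dOne n k),
        h.ε (h.ϑ u) = 1 → (u : MotivicHit.N n) ∉ MotivicHit.hit (ZMod 2) 0 n) ∧
    (∀ S : Finset (Fin k ↪o Fin n), Odd S.card →
      ((∑ σ ∈ S, MotivicHit.mon (ZMod 2) 0 (MotivicHit.zMono σ) : MotivicHit.N n) ∉
          MotivicHit.hit (ZMod 2) 0 n ∧
        ∃ hu : (∑ σ ∈ S, MotivicHit.mon (ZMod 2) 0 (MotivicHit.zMono σ) : MotivicHit.N n) ∈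
            MotivicHit.degreePart (ZMod 2) 0 n (k + 2 * MotivicHit.dOne n k),
          (Submodule.Quotient.mk ⟨_, hu⟩ :
            MotivicHit.HitQuotient (ZMod 2) 0 n (k + 2 * MotivicHit.dOne n k)) ≠ 0) ∧
      ((∑ σ ∈ S, MotivicHit.mon (Polynomial (ZMod 2)) Polynomial.X (MotivicHit.zMono σ) :
            MotivicHit.M n) ∉ MotivicHit.hit (Polynomial (ZMod 2)) Polynomial.X n ∧
        ∃ hu : (∑ σ ∈ S, MotivicHit.mon (Polynomial (ZMod 2)) Polynomial.X
              (MotivicHit.zMono σ) : MotivicHit.M n) ∈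
            MotivicHit.degreePart (Polynomial (ZMod 2)) Polynomial.X n
              (k + 2 * MotivicHit.dOne n k),
          (Submodule.Quotient.mk ⟨_, hu⟩ :
            MotivicHit.HitQuotient (Polynomial (ZMod 2)) Polynomial.X n
              (k + 2 * MotivicHit.dOne n k)) ≠ 0)) := by
  refine ⟨MotivicHit.exists_isComplementaryBlock (by omega), fun M₀ h =>
    ⟨h.ε_ne_zero hkn.le, h.hitImage_eq_ker hk hkn.le, fun u hu hhit => ?_⟩, fun S hS => ?_⟩
  · rw [h.ε_ϑ (by omega), MotivicHit.parity_eq_zero_of_mem_hit hk hhit] at hu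
    exact zero_ne_one hu
  · have hN : (∑ σ ∈ S, MotivicHit.mon (ZMod 2) 0 (MotivicHit.zMono σ) : MotivicHit.N n) ∉
        MotivicHit.hit (ZMod 2) 0 n := fun hhit => by
      have h0 := MotivicHit.parity_eq_zero_of_mem_hit hk hhit
      rw [MotivicHit.parity_sum_zMono hS] at h0
      exact one_ne_zero h0
    have hM : (∑ σ ∈ S, MotivicHit.mon (Polynomial (ZMod 2)) Polynomial.X (MotivicHit.zMono σ) :
        MotivicHit.M n) ∉ MotivicHit.hit (Polynomial (ZMod 2)) Polynomial.X n := fun hhit => by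
      have h0 := MotivicHit.parity_reduction_eq_zero_of_mem_hit hk hhit
      rw [map_sum, Finset.sum_congr rfl fun σ _ => MotivicHit.reduction_mon _,
        MotivicHit.parity_sum_zMono hS] at h0
      exact one_ne_zero h0
    exact ⟨⟨hN, MotivicHit.sum_zMono_mem_degreePart _ _ S,
        fun h0 => hN (Submodule.mem_comap.1 ((Submodule.Quotient.mk_eq_zero _).1 h0))⟩,
      ⟨hM, MotivicHit.sum_zMono_mem_degreePart _ _ S,
        fun h0 => hM (Submodule.mem_comap.1 ((Submodule.Quotient.mk_eq_zero _).1 h0))⟩⟩
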